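/- Let $\mathbb K=\mathbb R$ or $\mathbb C$. "Smooth" means $C^\infty$ if $\mathbb K=\mathbb R$ and holomorphic if $\mathbb K=\mathbb C$, and manifolds and diffeomorphisms are smooth in this sense. For a smooth $(1,1)$-tensor field $G$ on a manifold $M$ (a smooth field of endomorphisms $G(p):T_pM\to T_pM$), let $N_G(X,Y)=[GX,GY]-G[GX,Y]-G[X,GY]+G^2[X,Y]$ be its Nijenhuis torsion; $N_G=0$ means that $N_G(X,Y)=0$ for all smooth vector fields $X,Y$ defined on open subsets of $M$. Let $\varphi(p)(t)=\det(t-G(p))$ be its characteristic polynomial at $p\in M$. **Proposition A.1.** Let $G$ be a smooth $(1,1)$-tensor field on an $n$-manifold $M$ over $\mathbb K$ with $N_G=0$. Suppose that $\varphi(p)=\varphi_1(p)\,\varphi_2(p)$ for every $p\in M$, where $\varphi_1,\varphi_2$ are monic polynomials of respective degrees $n_1,n_2$ in one variable, whose coefficients are smooth functions on $M$, and where $\varphi_1(p),\varphi_2(p)\in\mathbb K[t]$ are relatively prime for every $p\in M$. Then for every point $p\in M$ there are an open neighbourhood $U$ of $p$, manifolds $M_1,M_2$ of dimensions $n_1,n_2$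 (which can be taken to be open subsets of $\mathbb K^{n_1}$, $\mathbb K^{n_2}$), smooth $(1,1)$-tensor fields $G_1$ on $M_1$ and $G_2$ on $M_2$ with $N_{G_1}=0$ and $N_{G_2}=0$, and a diffeomorphism $\Phi:M_1\times M_2\to U$ that carries $G_1\times G_2$ to $G|_U$, that is $d\Phi\circ(G_1\times G_2)=G\circ d\Phi$, such that for all $(x,y)\in M_1\times M_2$ the characteristic polynomial of $G_1$ at $x$ is $\varphi_1(\Phi(x,y))$ and that of $G_2$ at $y$ is $\varphi_2(\Phi(x,y))$. -/

import Mathlib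

open scoped Manifold ContDiff Polynomial

section TensorFields

variable {𝕜 : Type*} [RCLike 𝕜]
  {E : Type*} [NormedAddCommGroup E] [NormedSpace 𝕜 E]
  {H : Type*} [TopologicalSpace H] (I : ModelWithCorners 𝕜 E H)
  (M : Type*) [TopologicalSpace M] [ChartedSpace H M]
  {E' : Type*} [NormedAddCommGroup E'] [NormedSpace 𝕜 E']
  {H' : Type*} [TopologicalSpace H'] (I' : ModelWithCorners 𝕜 E' H')
  (M' : Type*) [TopologicalSpace M'] [ChartedSpace H' M']

/-- A (not necessarily smooth) vector field on `M`. -/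
abbrev VecField : Type _ := (x : M) → TangentSpace I x

/-- A (not necessarily smooth) `(1,1)`-tensor field on `M`: an endomorphism of each tangent
space. -/
abbrev TensorField11 : Type _ := (x : M) → TangentSpace I x →L[𝕜] TangentSpace I x

variable {I M}

/-- The vector field `X` is smooth on `U` (`C^∞` if `𝕜 = ℝ`, holomorphic if `𝕜 = ℂ`). -/
def VecField.SmoothOn [IsManifold I 1 M] (X : VecField I M) (U : Set M) : Prop :=
  ContMDiffOn I I.tangent ∞ (fun x => (⟨x, X x⟩ : TangentBundle I M)) U

namespace TensorField11

/-- The tensor field `G` is smooth (`C^∞` if `𝕜 = ℝ`, holomorphic if `𝕜 = ℂ`), as a section of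
the bundle of endomorphisms of the tangent bundle. -/
def Smooth [IsManifold I 1 M] (G : TensorField11 I M) : Prop :=
  ContMDiff I (I.prod 𝓘(𝕜, E →L[𝕜] E)) ∞
    (fun x => Bundle.TotalSpace.mk' (E →L[𝕜] E)
      (E := fun x : M => TangentSpace I x →L[𝕜] TangentSpace I x) x (G x))

/-- The vector field `G X`. -/
noncomputable def app (G : TensorField11 I M) (X : VecField I M) : VecField I M := fun x => G x (X x)

/-- `N_G(X, Y) = [G X, G Y] - G [G X, Y] - G [X, G Y] + G² [X, Y]`. -/
noncomputable def nijenhuis (G : TensorField11 I M) (X Y : VecField I M) : VecField I M :=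
  VectorField.mlieBracket I (G.app X) (G.app Y)
    - G.app (VectorField.mlieBracket I (G.app X) Y)
    - G.app (VectorField.mlieBracket I X (G.app Y))
    + G.app (G.app (VectorField.mlieBracket I X Y))

/-- `N_G = 0`. Since a complex manifold may have few global holomorphic vector fields, the
torsion is evaluated on vector fields that are smooth on an arbitrary open set. -/
def TorsionFree [IsManifold I 1 M] (G : TensorField11 I M) : Prop :=
  ∀ (U : Set M), IsOpen U → ∀ X Y : VecField I M, X.SmoothOn U → Y.SmoothOn U →
    ∀ p ∈ U, G.nijenhuis X Y p = 0

/-- The characteristic polynomial `det (t - G(p))` of `G` at the point `p`. -/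
noncomputable def charpoly [FiniteDimensional 𝕜 E] (G : TensorField11 I M) (p : M) : 𝕜[X] :=
  haveI : FiniteDimensional 𝕜 (TangentSpace I p) := inferInstanceAs (FiniteDimensional 𝕜 E)
  LinearMap.charpoly (G p : TangentSpace I p →ₗ[𝕜] TangentSpace I p)

variable {I' M'}

/-- The tensor field `G × G'` on `M × M'`, acting on
`T_(x,y) (M × M') = T_x M × T_y M'` componentwise. -/
noncomputable def prod (G : TensorField11 I M) (G' : TensorField11 I' M') :
    TensorField11 (I.prod I') (M × M') :=
  fun z => (G z.1).prodMap (G' z.2)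

/-- `G` and `G'` correspond to each other under `f : M → M'`, that is `df ∘ G = G' ∘ df`. -/
def Related (f : M → M') (G : TensorField11 I M) (G' : TensorField11 I' M') : Prop :=
  ∀ (x : M) (v : TangentSpace I x), mfderiv I I' f x (G x v) = G' (f x) (mfderiv I I' f x v)

end TensorField11

end TensorFields

/-! Coprimality splits the tangent bundle as ker φ₁(G) ⊕ ker φ₂(G). The projection onto the first
summand along the second is P = (φ₂(G) + φ₁(G))⁻¹ φ₂(G) (`spectralProj`), a formula that is visibly
smooth. Everything rests on one algebraic fact, `eq_zero_of_commute_of_spectralProj`: an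
endomorphism that commutes with G and maps one summand to the other is zero, because both φ₁(G) and
φ₂(G) kill its image while their sum is invertible.

Both summands are involutive. Modulo the range of P, the bracket of two sections of this range is a
bilinear map Ω, and N_G = 0 becomes Ω(Gv, Gw) − GΩ(Gv, w) − GΩ(v, Gw) + G²Ω(v, w) = 0. Two
applications of the algebraic fact give Ω = 0 (`isInvolutiveAt_spectralProj`). Exchanging φ₁ and φ₂
treats the other summand. By Frobenius each distribution has a first integral; the two together form
coordinates (x, y) in which P is the constant projection to the first factor
(`exists_product_coordinates`, `exists_adapted_chart`).

In these coordinates G = a ⊕ b is block diagonal. Torsion-freeness now says that the derivative of a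
in the y-directions commutes with G while mapping one summand to the other, so it vanishes; likewise
for b in the x-directions (`proj_fderiv_eq_zero`). Hence a depends on x only and b on y only. Their
characteristic polynomials have product φ₁φ₂, and φ₁(a) = 0, φ₂(b) = 0, which forces them to be φ₁
and φ₂ (`blocks_of_spectralProj`).

The real and the holomorphic case are treated together. Frobenius is proved by integrating along
rays in real time, and smoothness over 𝕜 in the initial data comes from an implicit function
argument in the Banach space of continuous paths (`contDiffOn_superposition`,
`exists_contDiffOn_fixedPoint`). -/

section Auxiliary

open Set Filter Topology

/-! ### Smoothness of composition operators on spaces of continuous maps. -/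

section Superposition

variable {𝕜 : Type*} [RCLike 𝕜] {K : Type*} [TopologicalSpace K]

open Classical in
/-- The superposition operator `γ ↦ f ∘ γ` on continuous maps, with value `0` where `f ∘ γ` is not
continuous. -/
noncomputable def superposition {A B : Type*} [TopologicalSpace A] [TopologicalSpace B] [Zero B]
    (f : A → B) (γ : C(K, A)) : C(K, B) :=
  if h : Continuous (f ∘ γ) then ⟨f ∘ γ, h⟩ else 0

theorem superposition_apply {A B : Type*} [TopologicalSpace A] [TopologicalSpace B] [Zero B]
    {f : A → B} {U : Set A} (hf : ContinuousOn f U) {γ : C(K, A)} (hγ : ∀ s, γ s ∈ U) (s : K) :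
    superposition f γ s = f (γ s) := by
  have h : Continuous (f ∘ γ) := hf.comp_continuous γ.continuous hγ
  simp [superposition, h]

variable [CompactSpace K]

variable (𝕜 K) in
/-- Pointwise application of a continuous family of linear maps to a continuous map. -/
noncomputable def ContinuousMap.pointwiseApplyL (A B : Type*) [NormedAddCommGroup A]
    [NormedSpace 𝕜 A] [NormedAddCommGroup B] [NormedSpace 𝕜 B] :
    C(K, A →L[𝕜] B) →L[𝕜] C(K, A) →L[𝕜] C(K, B) :=
  LinearMap.mkContinuous₂
    (LinearMap.mk₂ 𝕜 (fun (l : C(K, A →L[𝕜] B)) (h : C(K, A)) =>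
      (⟨fun s => l s (h s), l.continuous.clm_apply h.continuous⟩ : C(K, B)))
      (fun _ _ _ => by ext; simp) (fun _ _ _ => by ext; simp)
      (fun _ _ _ => by ext; simp) (fun _ _ _ => by ext; simp)) 1
    (fun l h => by
      rw [ContinuousMap.norm_le _ (by positivity)]
      intro s
      refine ((l s).le_opNorm (h s)).trans ?_
      rw [one_mul]
      exact mul_le_mul (l.norm_coe_le_norm s) (h.norm_coe_le_norm s) (by positivity)
        (by positivity))

theorem ContinuousMap.pointwiseApplyL_apply {A B : Type*} [NormedAddCommGroup A]
    [NormedSpace 𝕜 A] [NormedAddCommGroup B] [NormedSpace 𝕜 B]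
    (l : C(K, A →L[𝕜] B)) (h : C(K, A)) (s : K) :
    ContinuousMap.pointwiseApplyL 𝕜 K A B l h s = l s (h s) := rfl

theorem ContinuousMap.isOpen_setOf_forall_mem {A : Type*} [TopologicalSpace A] {U : Set A}
    (hU : IsOpen U) : IsOpen {γ : C(K, A) | ∀ s, γ s ∈ U} := by
  simpa [MapsTo] using ContinuousMap.isOpen_setOfPred_mapsTo (X := K) (Y := A) isCompact_univ hU

/-- Compactness gives one δ for all centres in S, with y free to leave S. Applied to the range of a
path, it turns pointwise estimates into sup-norm estimates. -/
theorem exists_ball_dist_lt_of_continuousOn {A B : Type*} [PseudoMetricSpace A]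
    [PseudoMetricSpace B] {f : A → B} {U S : Set A} (hU : IsOpen U) (hf : ContinuousOn f U)
    (hS : IsCompact S) (hSU : S ⊆ U) {ε : ℝ} (hε : 0 < ε) :
    ∃ δ > 0, ∀ x ∈ S, ∀ y ∈ Metric.ball x δ, y ∈ U ∧ dist (f y) (f x) < ε := by
  obtain ⟨δ₁, hδ₁, h₁⟩ := hS.exists_thickening_subset_open hU hSU
  have h₂ := hS.uniformContinuousAt_of_continuousAt f
    (fun a ha => hf.continuousAt (hU.mem_nhds (hSU ha))) (Metric.dist_mem_uniformity hε)
  obtain ⟨δ₂, hδ₂, h₂⟩ := Metric.mem_uniformity_dist.1 h₂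
  refine ⟨min δ₁ δ₂, lt_min hδ₁ hδ₂, fun x hx y hy => ⟨h₁ ?_, ?_⟩⟩
  · exact Metric.mem_thickening_iff.2 ⟨x, hx, lt_of_lt_of_le hy (min_le_left _ _)⟩
  · have hxy : dist x y < δ₂ := by
      rw [dist_comm]; exact lt_of_lt_of_le hy (min_le_right _ _)
    have := h₂ hxy hx
    rw [dist_comm]
    exact this

theorem continuousOn_superposition {A B : Type*} [NormedAddCommGroup A] [NormedAddCommGroup B]
    {f : A → B} {U : Set A} (hU : IsOpen U) (hf : ContinuousOn f U) :
    ContinuousOn (superposition (K := K) f) {γ | ∀ s, γ s ∈ U} := by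
  intro γ hγ
  apply ContinuousAt.continuousWithinAt
  rw [Metric.continuousAt_iff]
  intro ε hε
  obtain ⟨δ, hδ, h⟩ := exists_ball_dist_lt_of_continuousOn hU hf
    (isCompact_range γ.continuous) (range_subset_iff.2 hγ) (half_pos hε)
  refine ⟨δ, hδ, fun {η} hη => ?_⟩
  have hη' : ∀ s, η s ∈ Metric.ball (γ s) δ := fun s =>
    lt_of_le_of_lt (ContinuousMap.dist_apply_le_dist s) hη
  refine lt_of_le_of_lt ((ContinuousMap.dist_le (half_pos hε).le).2 fun s => ?_) (half_lt_self hε)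
  rw [superposition_apply hf hγ, superposition_apply hf fun s => (h _ ⟨s, rfl⟩ _ (hη' s)).1]
  exact (h _ ⟨s, rfl⟩ _ (hη' s)).2.le

/-- The mean value inequality on the balls of radius δ around γ s bounds the remainder by ε‖η‖,
since f' varies there by less than ε, uniformly in s. -/
theorem hasFDerivAt_superposition {A B : Type*} [NormedAddCommGroup A]
    [NormedSpace 𝕜 A] [NormedAddCommGroup B] [NormedSpace 𝕜 B]
    {f : A → B} {U : Set A} (hU : IsOpen U) (hf : ContDiffOn 𝕜 1 f U) {γ : C(K, A)}
    (hγ : ∀ s, γ s ∈ U) :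
    HasFDerivAt (superposition (K := K) f)
      (ContinuousMap.pointwiseApplyL 𝕜 K A B (superposition (fderiv 𝕜 f) γ)) γ := by
  let _ := NormedSpace.restrictScalars ℝ 𝕜 A
  have hf' : ContinuousOn (fderiv 𝕜 f) U := hf.continuousOn_fderiv_of_isOpen hU le_rfl
  rw [hasFDerivAt_iff_isLittleO_nhds_zero, Asymptotics.isLittleO_iff]
  intro ε hε
  obtain ⟨δ, hδ, h⟩ := exists_ball_dist_lt_of_continuousOn hU hf'
    (isCompact_range γ.continuous) (range_subset_iff.2 hγ) hε
  filter_upwards [Metric.ball_mem_nhds (0 : C(K, A)) hδ] with η hη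
  have hηn : ‖η‖ < δ := by simpa using hη
  have hη' : ∀ s, (γ + η) s ∈ Metric.ball (γ s) δ := fun s => by
    simpa using lt_of_le_of_lt (η.norm_coe_le_norm s) hηn
  rw [ContinuousMap.norm_le _ (by positivity)]
  intro s
  have hball : ∀ y ∈ Metric.ball (γ s) δ, y ∈ U ∧ dist (fderiv 𝕜 f y) (fderiv 𝕜 f (γ s)) < ε :=
    h _ ⟨s, rfl⟩
  simp only [ContinuousMap.sub_apply, ContinuousMap.pointwiseApplyL_apply]
  rw [superposition_apply hf.continuousOn hγ, superposition_apply hf' hγ,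
    superposition_apply hf.continuousOn fun s => (h _ ⟨s, rfl⟩ _ (hη' s)).1]
  have key := (convex_ball (γ s) δ).norm_image_sub_le_of_norm_hasFDerivWithin_le' (𝕜 := 𝕜)
    (f := f) (f' := fderiv 𝕜 f) (φ := fderiv 𝕜 f (γ s)) (C := ε)
    (fun y hy => (((hf.differentiableOn one_ne_zero).differentiableAt
      (hU.mem_nhds (hball y hy).1)).hasFDerivAt).hasFDerivWithinAt)
    (fun y hy => by rw [← dist_eq_norm]; exact (hball y hy).2.le)
    (Metric.mem_ball_self hδ) (hη' s)
  simp only [ContinuousMap.add_apply, add_sub_cancel_left] at key ⊢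
  exact key.trans (mul_le_mul_of_nonneg_left (η.norm_coe_le_norm s) hε.le)

-- The derivative is the superposition operator of f' followed by a fixed continuous linear map, so
-- induction applies. The induction changes the target to A →L[𝕜] B; the common universe keeps that
-- space within the range of the quantifier over B.
universe u in
theorem contDiffOn_superposition_nat {A : Type u} [NormedAddCommGroup A]
    [NormedSpace 𝕜 A] {U : Set A} (hU : IsOpen U) (n : ℕ) :
    ∀ {B : Type u} [NormedAddCommGroup B] [NormedSpace 𝕜 B] {f : A → B},
      ContDiffOn 𝕜 n f U → ContDiffOn 𝕜 n (superposition (K := K) f) {γ | ∀ s, γ s ∈ U} := by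
  induction n with
  | zero =>
    intro B _ _ f hf
    exact contDiffOn_zero.2 (continuousOn_superposition hU hf.continuousOn)
  | succ n ih =>
    intro B _ _ f hf
    have hf1 : ContDiffOn 𝕜 1 f U := hf.of_le (by norm_cast; omega)
    have hd : ∀ γ ∈ {γ : C(K, A) | ∀ s, γ s ∈ U}, HasFDerivAt (superposition (K := K) f)
      (ContinuousMap.pointwiseApplyL 𝕜 K A B (superposition (fderiv 𝕜 f) γ)) γ :=
      fun γ hγ => hasFDerivAt_superposition hU hf1 hγ
    push_cast at hf ⊢
    rw [contDiffOn_succ_iff_fderiv_of_isOpen (ContinuousMap.isOpen_setOf_forall_mem hU)]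
    rw [contDiffOn_succ_iff_fderiv_of_isOpen hU] at hf
    refine ⟨fun γ hγ => (hd γ hγ).differentiableAt.differentiableWithinAt, by simp, ?_⟩
    refine ContDiffOn.congr ?_ fun γ hγ => (hd γ hγ).fderiv
    exact (ContinuousMap.pointwiseApplyL 𝕜 K A B).contDiff.comp_contDiffOn (ih hf.2.2)

universe u in
theorem contDiffOn_superposition {A B : Type u} [NormedAddCommGroup A]
    [NormedSpace 𝕜 A] [NormedAddCommGroup B] [NormedSpace 𝕜 B] {U : Set A} (hU : IsOpen U)
    {f : A → B} (hf : ContDiffOn 𝕜 ∞ f U) :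
    ContDiffOn 𝕜 ∞ (superposition (K := K) f) {γ | ∀ s, γ s ∈ U} :=
  contDiffOn_infty.2 fun n => contDiffOn_superposition_nat hU n (contDiffOn_infty.1 hf n)

end Superposition

/-! ### Inverse functions and fixed points depending on a parameter. -/

section InverseFunction

variable {𝕜 : Type*} [RCLike 𝕜] {E F : Type*} [NormedAddCommGroup E] [NormedSpace 𝕜 E]
  [NormedAddCommGroup F] [NormedSpace 𝕜 F] [CompleteSpace E]

/-- The inverse function theorem, with a smooth inverse on an open set. -/
theorem ContDiffOn.exists_openPartialHomeomorph {f : E → F} {U : Set E} (hU : IsOpen U)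
    (hf : ContDiffOn 𝕜 ∞ f U) {a : E} (ha : a ∈ U) {f' : E ≃L[𝕜] F}
    (hf' : HasFDerivAt f (f' : E →L[𝕜] F) a) :
    ∃ e : OpenPartialHomeomorph E F, (e : E → F) = f ∧ a ∈ e.source ∧ e.source ⊆ U ∧
      ContDiffOn 𝕜 ∞ e.symm e.target := by
  have hfa : ContDiffAt 𝕜 ∞ f a := hf.contDiffAt (hU.mem_nhds ha)
  let e₀ := hfa.toOpenPartialHomeomorph f hf' (by simp)
  have hd : ContinuousOn (fderiv 𝕜 f) U := hf.continuousOn_fderiv_of_isOpen hU (by simp)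
  -- Restricting to the open set where the derivative is invertible makes the inverse smooth on its
  -- whole domain, not only at the image of a.
  let V : Set E := U ∩ fderiv 𝕜 f ⁻¹' range ((↑) : (E ≃L[𝕜] F) → E →L[𝕜] F)
  have hV : IsOpen V := hd.isOpen_inter_preimage hU ContinuousLinearEquiv.isOpen
  refine ⟨e₀.restrOpen V hV, rfl, ⟨hfa.mem_toOpenPartialHomeomorph_source hf' (by simp), ha, f',
    hf'.fderiv.symm⟩, fun x hx => hx.2.1, fun y hy => ?_⟩
  have hy' := (e₀.restrOpen V hV).map_target hy
  obtain ⟨hyU, g, hg⟩ := hy'.2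
  have hcd : ContDiffAt 𝕜 ∞ f ((e₀.restrOpen V hV).symm y) := hf.contDiffAt (hU.mem_nhds hyU)
  refine ((e₀.restrOpen V hV).contDiffAt_symm (f₀' := g) hy ?_ hcd).contDiffWithinAt
  rw [hg]
  exact (hcd.differentiableAt (by simp)).hasFDerivAt

end InverseFunction

section FixedPoint

variable {𝕜 : Type*} [RCLike 𝕜] {E F : Type*} [NormedAddCommGroup E] [NormedSpace 𝕜 E]
  [NormedAddCommGroup F] [NormedSpace 𝕜 F] [CompleteSpace E] [CompleteSpace F]

/-- Smooth dependence on the parameter of a fixed point of `N z`, when `N a` is constant. -/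
theorem exists_contDiffOn_fixedPoint {N : E × F → F} {O : Set (E × F)} (hO : IsOpen O)
    (hN : ContDiffOn 𝕜 ∞ N O) {a : E} {b : F} (hab : (a, b) ∈ O)
    (hconst : ∀ c, (a, c) ∈ O → N (a, c) = b) :
    ∃ (W : Set E) (Γ : E → F), IsOpen W ∧ a ∈ W ∧ ContDiffOn 𝕜 ∞ Γ W ∧
      ∀ z ∈ W, (z, Γ z) ∈ O ∧ Γ z = N (z, Γ z) := by
  have hNd : HasFDerivAt N (fderiv 𝕜 N (a, b)) (a, b) :=
    ((hN.contDiffAt (hO.mem_nhds hab)).differentiableAt (by simp)).hasFDerivAt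
  set L := fderiv 𝕜 N (a, b)
  have hL : L.comp (ContinuousLinearMap.inr 𝕜 E F) = 0 := by
    have h1 : HasFDerivAt (fun c : F => (a, c)) (ContinuousLinearMap.inr 𝕜 E F) b :=
      hasFDerivAt_prodMk_right a b
    have h2 := HasFDerivAt.comp b (g := N) (f := fun c : F => (a, c)) hNd h1
    refine h2.unique ((hasFDerivAt_const b b).congr_of_eventuallyEq ?_)
    filter_upwards [h1.continuousAt.preimage_mem_nhds (hO.mem_nhds hab)] with c hc
    exact hconst c hc
  have hL' : ∀ c : F, L (0, c) = 0 := fun c => by simpa using DFunLike.congr_fun hL c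
  have hLz : ∀ z c, L (z, c) = L (z, 0) := fun z c => by
    rw [← sub_eq_zero, ← map_sub]; simpa using hL' c
  -- Since L(z, c) = L(z, 0), the shears (z, c) ↦ (z, c ∓ L(z, c)) are mutually inverse. The inverse
  -- function theorem therefore applies without any contraction estimate.
  let D : (E × F) ≃L[𝕜] (E × F) := ContinuousLinearEquiv.equivOfInverse
    ((ContinuousLinearMap.fst 𝕜 E F).prod (ContinuousLinearMap.snd 𝕜 E F - L))
    ((ContinuousLinearMap.fst 𝕜 E F).prod (ContinuousLinearMap.snd 𝕜 E F + L))
    (fun x => by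
      ext
      · simp
      · simp [hLz x.1 x.2, hLz x.1 (x.2 - _)])
    (fun x => by
      ext
      · simp
      · simp [hLz x.1 x.2, hLz x.1 (x.2 + _)])
  let H : E × F → E × F := fun p => (p.1, p.2 - N p)
  have hH : ContDiffOn 𝕜 ∞ H O := contDiffOn_fst.prodMk (contDiffOn_snd.sub hN)
  have hHd : HasFDerivAt H (D : (E × F) →L[𝕜] (E × F)) (a, b) :=
    hasFDerivAt_fst.prodMk (hasFDerivAt_snd.sub hNd)
  obtain ⟨e, he, hea, heO, hes⟩ := hH.exists_openPartialHomeomorph hO hab hHd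
  let ι : E → E × F := fun z => (z, 0)
  have hι : ContDiff 𝕜 ∞ ι := contDiff_id.prodMk contDiff_const
  refine ⟨ι ⁻¹' e.target, fun z => (e.symm (z, 0)).2, e.open_target.preimage hι.continuous, ?_,
    contDiff_snd.comp_contDiffOn (hes.comp hι.contDiffOn fun z hz => hz), fun z hz => ?_⟩
  · have : e (a, b) = ι a := by rw [he]; simp [H, ι, hconst b hab]
    rw [mem_preimage, ← this]
    exact e.map_source hea
  · have h1 : H (e.symm (z, 0)) = (z, 0) := by rw [← he]; exact e.right_inv hz
    have h2 : (e.symm (z, 0)).1 = z := congrArg Prod.fst h1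
    have h3 : (z, (e.symm (z, 0)).2) = e.symm (z, 0) := Prod.ext h2.symm rfl
    refine ⟨by rw [h3]; exact heO (e.map_target hz), ?_⟩
    rw [h3]
    exact sub_eq_zero.1 (congrArg Prod.snd h1)

end FixedPoint

/-! ### Linear operators on paths over the unit interval. -/

section PathOperators

variable {𝕜 : Type*} [RCLike 𝕜] {A : Type*} [NormedAddCommGroup A] [NormedSpace 𝕜 A]

/-- The linear map sending a vector `y` to the path `s ↦ θ s • y`. -/
noncomputable def pathSMulL {K : Type*} [TopologicalSpace K] [CompactSpace K] (θ : C(K, 𝕜)) :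
    A →L[𝕜] C(K, A) :=
  LinearMap.mkContinuous
    { toFun := fun y => (⟨fun s => θ s • y, θ.continuous.smul continuous_const⟩ : C(K, A))
      map_add' := fun _ _ => by ext; simp
      map_smul' := fun c y => by ext s; simp [smul_comm (θ s) c y] } ‖θ‖
    (fun y => by
      rw [ContinuousMap.norm_le _ (by positivity)]
      intro s
      simp only [LinearMap.coe_mk, AddHom.coe_mk, ContinuousMap.coe_mk, norm_smul]
      exact mul_le_mul_of_nonneg_right (θ.norm_coe_le_norm s) (norm_nonneg _))

@[simp]
theorem pathSMulL_apply {K : Type*} [TopologicalSpace K] [CompactSpace K] (θ : C(K, 𝕜)) (y : A)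
    (s : K) : pathSMulL θ y s = θ s • y := rfl

variable [NormedSpace ℝ A] [SMulCommClass ℝ 𝕜 A]

/-- The primitive vanishing at `0` of a path on the unit interval. -/
noncomputable def pathPrimitiveL : C(unitInterval, A) →L[𝕜] C(unitInterval, A) :=
  LinearMap.mkContinuous
    { toFun := fun η => (⟨fun s => ∫ r in (0 : ℝ)..s, IccExtend (zero_le_one' ℝ) η r,
        (intervalIntegral.continuous_primitive
          (fun _ _ => (η.continuous.Icc_extend' (h := zero_le_one' ℝ)).intervalIntegrable _ _)
          0).comp continuous_subtype_val⟩ : C(unitInterval, A))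
      map_add' := fun η ζ => by
        ext s
        simpa [IccExtend] using intervalIntegral.integral_add
          ((η.continuous.Icc_extend' (h := zero_le_one' ℝ)).intervalIntegrable 0 (s : ℝ))
          ((ζ.continuous.Icc_extend' (h := zero_le_one' ℝ)).intervalIntegrable 0 (s : ℝ))
      map_smul' := fun c η => by
        ext s
        simp [IccExtend] } 1
    (fun η => by
      rw [ContinuousMap.norm_le _ (by positivity)]
      intro s
      simp only [LinearMap.coe_mk, AddHom.coe_mk, ContinuousMap.coe_mk, one_mul]
      refine (intervalIntegral.norm_integral_le_of_norm_le_const (C := ‖η‖)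
        fun r _ => η.norm_coe_le_norm _).trans ?_
      rw [sub_zero, abs_of_nonneg s.2.1]
      exact mul_le_of_le_one_right (norm_nonneg _) s.2.2)

theorem pathPrimitiveL_apply (η : C(unitInterval, A)) (s : unitInterval) :
    pathPrimitiveL (𝕜 := 𝕜) η s = ∫ r in (0 : ℝ)..s, IccExtend (zero_le_one' ℝ) η r := rfl

theorem hasDerivAt_integral_IccExtend [CompleteSpace A] (η : C(unitInterval, A)) (s : ℝ) :
    HasDerivAt (fun t => ∫ r in (0 : ℝ)..t, IccExtend (zero_le_one' ℝ) η r)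
      (IccExtend (zero_le_one' ℝ) η s) s := by
  have hc : Continuous (IccExtend (zero_le_one' ℝ) η) := η.continuous.Icc_extend'
  exact intervalIntegral.integral_hasDerivAt_right (hc.intervalIntegrable _ _)
    hc.stronglyMeasurable.stronglyMeasurableAtFilter hc.continuousAt

end PathOperators

/-! ### The Frobenius theorem for a distribution given as a graph. -/

section Frobenius

universe u

variable {𝕜 : Type*} [RCLike 𝕜]
  {A : Type u} [NormedAddCommGroup A] [NormedSpace 𝕜 A]
  {B : Type u} [NormedAddCommGroup B] [NormedSpace 𝕜 B]

variable (𝕜) in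
/-- The path `s ↦ 1 - s` of scalars. -/
noncomputable def reversedTime : C(unitInterval, 𝕜) :=
  ⟨fun s => ((1 - (s : ℝ) : ℝ) : 𝕜), by fun_prop⟩

variable (𝕜 A B) in
/-- The linear map sending `((x, y), γ)` to the path `s ↦ ((γ s, (1 - s) y), y)`. -/
noncomputable def rayPathL :
    ((A × B) × C(unitInterval, A)) →L[𝕜] C(unitInterval, (A × B) × B) :=
  (((ContinuousLinearMap.inl 𝕜 (A × B) B).comp
    (ContinuousLinearMap.inl 𝕜 A B)).compLeftContinuous 𝕜 unitInterval).comp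
      (ContinuousLinearMap.snd 𝕜 (A × B) C(unitInterval, A)) +
  ((((ContinuousLinearMap.inl 𝕜 (A × B) B).comp
    (ContinuousLinearMap.inr 𝕜 A B)).compLeftContinuous 𝕜 unitInterval).comp
      (pathSMulL (reversedTime 𝕜)) +
    ((ContinuousLinearMap.inr 𝕜 (A × B) B).compLeftContinuous 𝕜 unitInterval).comp
      (pathSMulL 1)).comp
      ((ContinuousLinearMap.snd 𝕜 A B).comp
        (ContinuousLinearMap.fst 𝕜 (A × B) C(unitInterval, A)))

theorem rayPathL_apply (z : A × B) (γ : C(unitInterval, A)) (s : unitInterval) :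
    rayPathL 𝕜 A B (z, γ) s = ((γ s, ((1 - (s : ℝ) : ℝ) : 𝕜) • z.2), z.2) := by
  simp [rayPathL, reversedTime]

variable {F : A × B → B →L[𝕜] A} {U : Set (A × B)}

/-- With F uncurried, the right-hand side of the ray equation is a single superposition operator
composed with the linear map `rayPathL`, so that its smoothness follows at once. -/
theorem contDiffOn_uncurried_clm (hF : ContDiffOn 𝕜 ∞ F U) :
    ContDiffOn 𝕜 ∞ (fun q : (A × B) × B => F q.1 q.2) (Prod.fst ⁻¹' U) :=
  (hF.comp contDiffOn_fst fun _ hq => hq).clm_apply contDiffOn_snd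

theorem fderiv_uncurried_clm (hU : IsOpen U) (hF : ContDiffOn 𝕜 ∞ F U) {p : A × B} (hp : p ∈ U)
    (c : B) (v : (A × B) × B) :
    fderiv 𝕜 (fun q : (A × B) × B => F q.1 q.2) (p, c) v =
      fderiv 𝕜 F p v.1 c + F p v.2 := by
  have hFp : HasFDerivAt F (fderiv 𝕜 F p) p :=
    ((hF.contDiffAt (hU.mem_nhds hp)).differentiableAt (by simp)).hasFDerivAt
  have h1 : HasFDerivAt (fun q : (A × B) × B => F q.1)
      ((fderiv 𝕜 F p).comp (ContinuousLinearMap.fst 𝕜 (A × B) B)) (p, c) :=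
    HasFDerivAt.comp (g := F) (f := Prod.fst) (p, c) hFp hasFDerivAt_fst
  rw [(h1.clm_apply hasFDerivAt_snd).fderiv]
  simp [add_comm]

theorem eq_zero_of_hasDerivAt_of_norm_le {A : Type*} [NormedAddCommGroup A] [NormedSpace ℝ A]
    {w w' : ℝ → A} {K : ℝ}
    (hw : ∀ s ∈ Icc (0 : ℝ) 1, HasDerivAt w (w' s) s)
    (hK : ∀ s ∈ Icc (0 : ℝ) 1, ‖w' s‖ ≤ K * ‖w s‖) (h0 : w 0 = 0) : w 1 = 0 :=
  eq_zero_of_abs_deriv_le_mul_abs_self_of_eq_zero_right (a := 0) (b := 1) (f' := w') (K := K)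
    (fun s hs => (hw s hs).continuousAt.continuousWithinAt)
    (fun s hs => (hw s (Ico_subset_Icc_self hs)).hasDerivWithinAt) h0
    (fun s hs => hK s (Ico_subset_Icc_self hs)) 1 (by simp)

theorem hasDerivAt_one_sub_smul {B : Type*} [NormedAddCommGroup B] [NormedSpace 𝕜 B]
    [NormedSpace ℝ B] [IsScalarTower ℝ 𝕜 B] (y : B) (t : ℝ) :
    HasDerivAt (fun s : ℝ => ((1 - s : ℝ) : 𝕜) • y) (-y) t := by
  simp_rw [← RCLike.real_smul_eq_coe_smul (K := 𝕜)]
  simpa using ((hasDerivAt_id t).const_sub 1).smul_const y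

variable [NormedSpace ℝ A] [IsScalarTower ℝ 𝕜 A]

/-- The solution operator of the initial value problem `γ' = - F (γ, (1 - s) y) y`, `γ 0 = x`:
its fixed points are the solutions. -/
noncomputable def rayPicard (F : A × B → B →L[𝕜] A) (p : (A × B) × C(unitInterval, A)) :
    C(unitInterval, A) :=
  pathSMulL (𝕜 := 𝕜) 1 p.1.1 -
    pathPrimitiveL (𝕜 := 𝕜) (superposition (fun q : (A × B) × B => F q.1 q.2)
      (rayPathL 𝕜 A B p))

variable [CompleteSpace A] [CompleteSpace B]

/-- At z = 0 the integrand F(γ, 0) 0 vanishes whatever γ is, so the Picard map is constant there.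
The fixed point theorem then gives, for all z near 0, a solution on the whole unit interval, smooth
in z. -/
theorem exists_rayPicard_fixedPoint (hU : IsOpen U) (h0 : (0 : A × B) ∈ U)
    (hF : ContDiffOn 𝕜 ∞ F U) :
    ∃ (W : Set (A × B)) (Γ : A × B → C(unitInterval, A)), IsOpen W ∧ 0 ∈ W ∧
      ContDiffOn 𝕜 ∞ Γ W ∧ ∀ z ∈ W, (∀ s, (rayPathL 𝕜 A B (z, Γ z) s).1 ∈ U) ∧
        Γ z = rayPicard F (z, Γ z) := by
  have hU' : IsOpen (Prod.fst ⁻¹' U : Set ((A × B) × B)) := hU.preimage continuous_fst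
  have hO := (ContinuousMap.isOpen_setOf_forall_mem (K := unitInterval) hU').preimage
    (rayPathL 𝕜 A B).continuous
  have hN : ContDiffOn 𝕜 ∞ (rayPicard F)
      (rayPathL 𝕜 A B ⁻¹' {γ | ∀ s, γ s ∈ (Prod.fst ⁻¹' U : Set ((A × B) × B))}) :=
    ((pathSMulL (𝕜 := 𝕜) 1).contDiff.comp (contDiff_fst.comp contDiff_fst)).contDiffOn.sub
      ((pathPrimitiveL (𝕜 := 𝕜)).contDiff.comp_contDiffOn
        ((contDiffOn_superposition hU' (contDiffOn_uncurried_clm hF)).comp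
          (rayPathL 𝕜 A B).contDiff.contDiffOn fun _ hp => hp))
  obtain ⟨W, Γ, hW, h0W, hΓ, h⟩ := exists_contDiffOn_fixedPoint hO hN (a := 0) (b := 0)
    (fun s => by rw [rayPathL_apply]; simpa [Prod.mk_zero_zero] using h0) (fun c hc => by
      have : superposition (fun q : (A × B) × B => F q.1 q.2) (rayPathL 𝕜 A B (0, c)) = 0 := by
        ext s
        rw [superposition_apply (contDiffOn_uncurried_clm hF).continuousOn hc, rayPathL_apply]
        simp
      simp [rayPicard, this])
  exact ⟨W, Γ, hW, h0W, hΓ, fun z hz => ⟨fun s => (h z hz).1 s, (h z hz).2⟩⟩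

variable [NormedSpace ℝ B] [IsScalarTower ℝ 𝕜 B]

/-- The Frobenius theorem for the distribution `{(F z w, w)}`: it is annihilated by the
differential of a smooth first integral `ξ`. -/
theorem exists_first_integral (hU : IsOpen U) (h0 : (0 : A × B) ∈ U) (hF : ContDiffOn 𝕜 ∞ F U)
    (hsymm : ∀ z ∈ U, ∀ v w : B, fderiv 𝕜 F z (F z v, v) w = fderiv 𝕜 F z (F z w, w) v) :
    ∃ (W : Set (A × B)) (ξ : A × B → A), IsOpen W ∧ 0 ∈ W ∧ W ⊆ U ∧ ContDiffOn 𝕜 ∞ ξ W ∧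
      (∀ x, (x, 0) ∈ W → ξ (x, 0) = x) ∧ ∀ z ∈ W, ∀ w, fderiv 𝕜 ξ z (F z w, w) = 0 := by
  obtain ⟨W, Γ, hW, h0W, hΓ, h⟩ := exists_rayPicard_fixedPoint hU h0 hF
  have hU' : IsOpen (Prod.fst ⁻¹' U : Set ((A × B) × B)) := hU.preimage continuous_fst
  have hF' := contDiffOn_uncurried_clm hF
  have hΓ0 : ∀ z ∈ W, Γ z 0 = z.1 := fun z hz => by
    conv_lhs => rw [(h z hz).2]
    simp [rayPicard, pathPrimitiveL_apply]
  have hWU : W ⊆ U := fun z hz => by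
    have := (h z hz).1 0
    rw [rayPathL_apply, hΓ0 z hz] at this
    simpa using this
  -- The first integral moves z = (x, y) within the distribution along the ray from y to 0 and reads
  -- off the A-coordinate of the end point.
  let ev : C(unitInterval, A) →L[𝕜] A := ContinuousMap.evalCLM 𝕜 1
  refine ⟨W, fun z => Γ z 1, hW, h0W, hWU, ev.contDiff.comp_contDiffOn hΓ, fun x hx => ?_,
    fun z hz w => ?_⟩
  · have : superposition (fun q : (A × B) × B => F q.1 q.2) (rayPathL 𝕜 A B ((x, 0), Γ (x, 0)))
        = 0 := by
      ext s
      rw [superposition_apply hF'.continuousOn fun s => (h _ hx).1 s, rayPathL_apply]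
      simp
    show Γ (x, 0) 1 = x
    rw [(h _ hx).2]
    simp [rayPicard, this]
  -- the variation `η` of the solution along `(F z w, w)` and its integral equation
  have hΓd : HasFDerivAt Γ (fderiv 𝕜 Γ z) z :=
    ((hΓ.contDiffAt (hW.mem_nhds hz)).differentiableAt (by simp)).hasFDerivAt
  set η := fderiv 𝕜 Γ z (F z w, w) with hη
  have hξ : fderiv 𝕜 (fun z => Γ z 1) z (F z w, w) = η 1 := by
    have : HasFDerivAt (fun z => Γ z 1) (ev.comp (fderiv 𝕜 Γ z)) z :=
      HasFDerivAt.comp z ev.hasFDerivAt hΓd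
    rw [this.fderiv]; rfl
  rw [hξ]
  set c := superposition (fun q : (A × B) × B => F q.1 q.2) (rayPathL 𝕜 A B (z, Γ z)) with hc
  set d := ContinuousMap.pointwiseApplyL 𝕜 unitInterval ((A × B) × B) A
    (superposition (fderiv 𝕜 fun q : (A × B) × B => F q.1 q.2) (rayPathL 𝕜 A B (z, Γ z)))
    (rayPathL 𝕜 A B ((F z w, w), η)) with hd
  have hηeq : η = pathSMulL (𝕜 := 𝕜) 1 (F z w) - pathPrimitiveL (𝕜 := 𝕜) d := by
    have h1 : HasFDerivAt (fun z => (z, Γ z)) ((ContinuousLinearMap.id 𝕜 (A × B)).prod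
      (fderiv 𝕜 Γ z)) z := (hasFDerivAt_id z).prodMk hΓd
    have h2 := hasFDerivAt_superposition hU' (hF'.of_le (by simp)) fun s => (h z hz).1 s
    have h3 : HasFDerivAt (fun z => superposition (fun q : (A × B) × B => F q.1 q.2)
        (rayPathL 𝕜 A B (z, Γ z))) _ z :=
      HasFDerivAt.comp (g := superposition (fun q : (A × B) × B => F q.1 q.2)) z h2
        (HasFDerivAt.comp z (rayPathL 𝕜 A B).hasFDerivAt h1)
    have h4 : HasFDerivAt (fun z : A × B => pathSMulL (K := unitInterval) (𝕜 := 𝕜) 1 z.1) _ z :=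
      HasFDerivAt.comp z (pathSMulL (K := unitInterval) (𝕜 := 𝕜) (A := A) 1).hasFDerivAt
        (hasFDerivAt_fst (p := z))
    have h5 := h4.sub (HasFDerivAt.comp z (pathPrimitiveL (𝕜 := 𝕜)).hasFDerivAt h3)
    have h6 := h5.congr_of_eventuallyEq (f₁ := Γ) (by
      filter_upwards [hW.mem_nhds hz] with y hy using (h y hy).2)
    rw [hη, h6.fderiv]
    simp [hd, hη]
  let γ' : ℝ → A := fun t => z.1 - ∫ r in (0 : ℝ)..t, IccExtend (zero_le_one' ℝ) c r
  let η' : ℝ → A := fun t => F z w - ∫ r in (0 : ℝ)..t, IccExtend (zero_le_one' ℝ) d r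
  let θ : ℝ → 𝕜 := fun t => ((1 - t : ℝ) : 𝕜)
  let q : ℝ → A × B := fun t => (γ' t, θ t • z.2)
  have hγ' : ∀ s : unitInterval, Γ z s = γ' s := fun s => by
    conv_lhs => rw [(h z hz).2]
    simp [rayPicard, pathPrimitiveL_apply, γ', hc]
  have hη' : ∀ s : unitInterval, η s = η' s := fun s => by
    conv_lhs => rw [hηeq]
    simp [pathPrimitiveL_apply, η']
  have hpath : ∀ s : unitInterval, rayPathL 𝕜 A B (z, Γ z) s = (q s, z.2) := fun s => by
    rw [rayPathL_apply, hγ']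
  have hqU : ∀ s : unitInterval, q s ∈ U := fun s => by
    have := (h z hz).1 s
    rwa [hpath] at this
  have hcs : ∀ s : unitInterval, c s = F (q s) z.2 := fun s => by
    rw [hc, superposition_apply hF'.continuousOn fun s => (h _ hz).1 s, hpath]
  have hds : ∀ s : unitInterval, d s =
      fderiv 𝕜 F (q s) (η' s, θ s • w) z.2 + F (q s) w := fun s => by
    rw [hd, ContinuousMap.pointwiseApplyL_apply, superposition_apply
      (hF'.continuousOn_fderiv_of_isOpen hU' (by simp)) fun s => (h _ hz).1 s, hpath,
      fderiv_uncurried_clm hU hF (hqU s), rayPathL_apply, hη']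
  -- the difference between the variation and the distribution satisfies a linear equation
  let δ : ℝ → A := fun t => η' t - F (q t) (θ t • w)
  have hδ : ∀ t ∈ Icc (0 : ℝ) 1, HasDerivAt δ (-fderiv 𝕜 F (q t) (δ t, 0) z.2) t := by
    intro t ht
    have hγd : HasDerivAt γ' (-F (q t) z.2) t := by
      have := (hasDerivAt_integral_IccExtend c t).const_sub z.1
      rwa [IccExtend_of_mem _ _ ht, hcs] at this
    have hηd : HasDerivAt η' (-(fderiv 𝕜 F (q t) (η' t, θ t • w) z.2 + F (q t) w)) t := by
      have := (hasDerivAt_integral_IccExtend d t).const_sub (F z w)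
      rwa [IccExtend_of_mem _ _ ht, hds] at this
    have hcurve : HasDerivAt (fun t => (q t, θ t • w)) ((-F (q t) z.2, -z.2), -w) t :=
      (hγd.prodMk (hasDerivAt_one_sub_smul z.2 t)).prodMk (hasDerivAt_one_sub_smul w t)
    have hFd : HasFDerivAt (fun q : (A × B) × B => F q.1 q.2) _ (q t, θ t • w) :=
      ((hF'.contDiffAt (hU'.mem_nhds (hqU ⟨t, ht⟩))).differentiableAt (by simp)).hasFDerivAt
    have hcomp := (hFd.restrictScalars ℝ).comp_hasDerivAt t hcurve
    convert! hηd.sub hcomp using 1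
    rw [ContinuousLinearMap.coe_restrictScalars', fderiv_uncurried_clm hU hF (hqU ⟨t, ht⟩)]
    -- The terms F(q)w cancel, and `hsymm` exchanges `z.2` with w in the term coming from the motion
    -- of the base point. What remains is linear in δ.
    have e1 : ((-F (q t) z.2, -z.2) : A × B) = -(F (q t) z.2, z.2) := rfl
    have e2 : ((δ t, 0) : A × B) = (η' t, θ t • w) - θ t • (F (q t) w, w) := by
      ext <;> simp [δ]
    simp only [e1, e2, map_neg, map_sub, map_smul, neg_apply,
      sub_apply, smul_apply, smul_neg, hsymm _ (hqU ⟨t, ht⟩) z.2 w]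
    abel
  have hq : Continuous fun s : unitInterval => q s :=
    (continuous_fst.comp (rayPathL 𝕜 A B (z, Γ z)).continuous).congr fun s => by simp [hpath]
  have hcont : Continuous fun s : unitInterval => ‖fderiv 𝕜 F (q s)‖ :=
    continuous_norm.comp
      ((hF.continuousOn_fderiv_of_isOpen hU (by simp)).comp_continuous hq hqU)
  obtain ⟨C, hC⟩ := (isCompact_range hcont).bddAbove
  have hδ1 : δ 1 = 0 := by
    refine eq_zero_of_hasDerivAt_of_norm_le (K := C * ‖z.2‖) hδ (fun t ht => ?_) ?_
    · rw [norm_neg]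
      refine (ContinuousLinearMap.le_opNorm _ _).trans ?_
      rw [mul_right_comm]
      refine mul_le_mul_of_nonneg_right ?_ (norm_nonneg _)
      refine (ContinuousLinearMap.le_opNorm _ _).trans ?_
      have h1 : ‖fderiv 𝕜 F (q t)‖ ≤ C := hC ⟨⟨t, ht⟩, rfl⟩
      have h2 : ‖((δ t, 0) : A × B)‖ = ‖δ t‖ := by simp [Prod.norm_def]
      rw [h2]
      exact mul_le_mul_of_nonneg_right h1 (norm_nonneg _)
    · simp [δ, η', q, θ, γ']
  -- The factor θ vanishes at time 1, where the ray reaches 0.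
  have : δ 1 = η' 1 := by simp [δ, θ]
  rw [hη' 1, Icc.coe_one, ← this, hδ1]

end Frobenius

/-! ### Algebra of the spectral projection. -/

section SpectralProjection

theorem Commute.ringInverse_left {M₀ : Type*} [MonoidWithZero M₀] {a b : M₀} (h : Commute a b) :
    Commute (Ring.inverse a) b := by
  by_cases ha : IsUnit a
  · obtain ⟨u, rfl⟩ := ha
    rw [Ring.inverse_unit]
    exact h.units_inv_left
  · rw [Ring.inverse_non_unit _ ha]
    exact Commute.zero_left b

variable {𝕜 R : Type*} [Field 𝕜] [Ring R] [Algebra 𝕜 R]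

/-- For coprime `φ₁`, `φ₂` with `(φ₁ φ₂)(g) = 0`, the projection onto `ker φ₁(g)` along
`ker φ₂(g)`. -/
noncomputable def spectralProj (φ₁ φ₂ : 𝕜[X]) (g : R) : R :=
  Ring.inverse (Polynomial.aeval g φ₂ + Polynomial.aeval g φ₁) * Polynomial.aeval g φ₂

variable {φ₁ φ₂ : 𝕜[X]} {g : R}

/-- The polynomial φ₂ + φ₁ is coprime to φ₁ and to φ₂, hence to their product, which annihilates g;
a Bézout relation evaluated at g exhibits the inverse. -/
theorem isUnit_aeval_add_aeval (hc : IsCoprime φ₁ φ₂) (hg : Polynomial.aeval g (φ₁ * φ₂) = 0) :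
    IsUnit (Polynomial.aeval g φ₂ + Polynomial.aeval g φ₁) := by
  have h1 : IsCoprime (φ₂ + φ₁) φ₁ := by
    simpa using hc.symm.add_mul_left_left 1
  have h2 : IsCoprime (φ₂ + φ₁) φ₂ := by
    simpa [add_comm] using hc.add_mul_left_left 1
  obtain ⟨u, v, huv⟩ := h1.mul_right h2
  have h3 : Polynomial.aeval g u * (Polynomial.aeval g φ₂ + Polynomial.aeval g φ₁) = 1 := by
    have := congrArg (Polynomial.aeval g) huv
    rwa [map_add, map_mul, map_mul _ v, hg, mul_zero, add_zero, map_one, map_add] at this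
  refine ⟨⟨_, Polynomial.aeval g u, ?_, h3⟩, rfl⟩
  rw [← map_add, ← map_mul, mul_comm, map_mul, map_add, h3]

theorem spectralProj_commute (φ₁ φ₂ ψ : 𝕜[X]) (g : R) :
    Commute (spectralProj φ₁ φ₂ g) (Polynomial.aeval g ψ) := by
  have h : ∀ a b : 𝕜[X], Commute (Polynomial.aeval g a) (Polynomial.aeval g b) := fun a b =>
    (Commute.all a b).map (Polynomial.aeval g)
  exact ((h φ₂ ψ).add_left (h φ₁ ψ)).ringInverse_left.mul_left (h φ₂ ψ)

theorem spectralProj_commute_self (φ₁ φ₂ : 𝕜[X]) (g : R) : Commute (spectralProj φ₁ φ₂ g) g := by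
  simpa using spectralProj_commute φ₁ φ₂ Polynomial.X g

theorem spectralProj_swap (hc : IsCoprime φ₁ φ₂) (hg : Polynomial.aeval g (φ₁ * φ₂) = 0) :
    spectralProj φ₂ φ₁ g = 1 - spectralProj φ₁ φ₂ g := by
  rw [eq_sub_iff_add_eq, spectralProj, spectralProj, add_comm (Polynomial.aeval g φ₁),
    ← mul_add, add_comm (Polynomial.aeval g φ₁),
    Ring.inverse_mul_cancel _ (isUnit_aeval_add_aeval hc hg)]

theorem aeval_mul_spectralProj (hg : Polynomial.aeval g (φ₁ * φ₂) = 0) :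
    Polynomial.aeval g φ₁ * spectralProj φ₁ φ₂ g = 0 := by
  rw [← (spectralProj_commute φ₁ φ₂ φ₁ g).eq, spectralProj, mul_assoc, ← map_mul, mul_comm φ₂, hg,
    mul_zero]

theorem spectralProj_mul_self (hc : IsCoprime φ₁ φ₂) (hg : Polynomial.aeval g (φ₁ * φ₂) = 0) :
    spectralProj φ₁ φ₂ g * spectralProj φ₁ φ₂ g = spectralProj φ₁ φ₂ g := by
  have h : spectralProj φ₂ φ₁ g * spectralProj φ₁ φ₂ g = 0 := by
    rw [spectralProj, mul_assoc, aeval_mul_spectralProj hg, mul_zero]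
  rw [spectralProj_swap hc hg, sub_mul, one_mul, sub_eq_zero] at h
  exact h.symm

/-- An endomorphism commuting with `g` and mapping `ker φ₁(g)` to `ker φ₂(g)` vanishes. -/
theorem eq_zero_of_commute_of_spectralProj (hc : IsCoprime φ₁ φ₂)
    (hg : Polynomial.aeval g (φ₁ * φ₂) = 0) {ψ : R} (hψ : Commute ψ g)
    (h₁ : ψ * spectralProj φ₁ φ₂ g = ψ) (h₂ : spectralProj φ₁ φ₂ g * ψ = 0) : ψ = 0 := by
  have hψp : ∀ p : 𝕜[X], Commute ψ (Polynomial.aeval g p) := fun p => by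
    induction p using Polynomial.induction_on' with
    | add p q hp hq => rw [map_add]; exact hp.add_right hq
    | monomial n a =>
      rw [Polynomial.aeval_monomial]
      exact (show Commute ψ _ from (Algebra.commutes a ψ).symm).mul_right (hψ.pow_right n)
  have hT : Polynomial.aeval g φ₁ * ψ = 0 := by
    rw [← (hψp φ₁).eq, ← h₁, mul_assoc, (spectralProj_commute φ₁ φ₂ φ₁ g).eq,
      aeval_mul_spectralProj hg, mul_zero]
  have hS : Polynomial.aeval g φ₂ * ψ = 0 := by
    have h3 : spectralProj φ₂ φ₁ g * ψ = ψ := by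
      rw [spectralProj_swap hc hg, sub_mul, h₂, one_mul, sub_zero]
    rw [← h3, ← mul_assoc, aeval_mul_spectralProj (by rw [mul_comm, hg]), zero_mul]
  refine (isUnit_aeval_add_aeval hc hg).mul_right_eq_zero.1 ?_
  rw [add_mul, hS, hT, add_zero]

end SpectralProjection

/-! ### Characteristic polynomials and coprime annihilating polynomials. -/

section Charpoly

variable {𝕜 : Type*} [Field 𝕜] {V : Type*} [AddCommGroup V] [Module 𝕜 V] [FiniteDimensional 𝕜 V]

/-- Over an algebraic closure every root of the characteristic polynomial is an eigenvalue, and by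
spectral mapping a root of φ. So it is not a root of ψ. -/
theorem LinearMap.isCoprime_charpoly_of_aeval_eq_zero {f : V →ₗ[𝕜] V} {φ ψ : 𝕜[X]}
    (h : IsCoprime φ ψ) (hf : Polynomial.aeval f φ = 0) : IsCoprime f.charpoly ψ := by
  let b := Module.finBasis 𝕜 V
  let M := LinearMap.toMatrixAlgEquiv b f
  let L := AlgebraicClosure 𝕜
  let M' := (Algebra.ofId 𝕜 L).mapMatrix M
  have hM' : Polynomial.aeval M' φ = 0 := by
    rw [Polynomial.aeval_algHom_apply, Polynomial.aeval_algHom_apply, hf, map_zero, map_zero]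
  have hch : M'.charpoly = f.charpoly.map (algebraMap 𝕜 L) := by
    rw [← LinearMap.charpoly_toMatrix f b]
    exact Matrix.charpoly_map M (algebraMap 𝕜 L)
  rw [Polynomial.isCoprime_iff_aeval_ne_zero_of_isAlgClosed 𝕜 L] at h ⊢
  intro μ
  refine or_iff_not_imp_left.2 fun hμ => ?_
  rw [not_not, ← Polynomial.eval_map_algebraMap, ← hch] at hμ
  have h1 : μ ∈ spectrum L M' := Matrix.mem_spectrum_of_isRoot_charpoly hμ
  have h2 := spectrum.subset_polynomial_aeval M' (φ.map (algebraMap 𝕜 L)) ⟨μ, h1, rfl⟩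
  rw [Polynomial.aeval_map_algebraMap, hM'] at h2
  have h3 : (Polynomial.aeval μ) φ = 0 := by
    rw [← Polynomial.eval_map_algebraMap]
    by_contra hne
    refine h2 (spectrum.mem_resolventSet_iff.2 ?_)
    rw [sub_zero]
    exact (Ne.isUnit hne).map (algebraMap L _)
  exact (h μ).resolve_left (not_not.2 h3)

/-- Coprimality lets the opposite factor be cancelled on either side, so the first characteristic
polynomial and φ divide each other; both are monic. -/
theorem LinearMap.charpoly_eq_of_mul_eq {V' : Type*} [AddCommGroup V'] [Module 𝕜 V']
    [FiniteDimensional 𝕜 V'] {f : V →ₗ[𝕜] V} {f' : V' →ₗ[𝕜] V'} {φ ψ : 𝕜[X]}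
    (h : IsCoprime φ ψ) (hφ : φ.Monic) (hf : Polynomial.aeval f φ = 0)
    (hf' : Polynomial.aeval f' ψ = 0) (hmul : f.charpoly * f'.charpoly = φ * ψ) :
    f.charpoly = φ ∧ f'.charpoly = ψ := by
  have h1 : f.charpoly ∣ φ :=
    (isCoprime_charpoly_of_aeval_eq_zero h hf).dvd_of_dvd_mul_right (hmul ▸ dvd_mul_right _ _)
  have h2 : φ ∣ f.charpoly :=
    (isCoprime_charpoly_of_aeval_eq_zero h.symm hf').symm.dvd_of_dvd_mul_right
      (hmul ▸ dvd_mul_right _ _)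
  have h3 := Polynomial.eq_of_monic_of_associated f.charpoly_monic hφ (associated_of_dvd_dvd h1 h2)
  refine ⟨h3, ?_⟩
  rw [h3] at hmul
  exact mul_left_cancel₀ hφ.ne_zero hmul

end Charpoly

/-! ### The bilinear form of the vanishing principle. -/

section BilinearIntertwining

variable {𝕜 : Type*} [NontriviallyNormedField 𝕜] {V : Type*} [NormedAddCommGroup V]
  [NormedSpace 𝕜 V] {φ₁ φ₂ : 𝕜[X]} {g : V →L[𝕜] V}

/-- A bilinear map `Ω` from `ker φ₁(g)` to `ker φ₂(g)` with
`Ω(g v, g w) - g Ω(g v, w) - g Ω(v, g w) + g² Ω(v, w) = 0` vanishes. -/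
theorem bilinear_eq_zero_of_spectralProj (hc : IsCoprime φ₁ φ₂)
    (hg : Polynomial.aeval g (φ₁ * φ₂) = 0) {Ω : V →L[𝕜] V →L[𝕜] V}
    (h₁ : ∀ v w, Ω (spectralProj φ₁ φ₂ g v) w = Ω v w)
    (h₂ : ∀ v w, Ω v (spectralProj φ₁ φ₂ g w) = Ω v w)
    (h₃ : ∀ v w, spectralProj φ₁ φ₂ g (Ω v w) = 0)
    (h : ∀ v w, Ω (g v) (g w) - g (Ω (g v) w) - g (Ω v (g w)) + g (g (Ω v w)) = 0) (v w : V) :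
    Ω v w = 0 := by
  have hPg : ∀ u, spectralProj φ₁ φ₂ g (g u) = g (spectralProj φ₁ φ₂ g u) := fun u =>
    DFunLike.congr_fun (spectralProj_commute_self φ₁ φ₂ g).eq u
  have key : ∀ v w, Ω v (g w) = g (Ω v w) := fun v w => by
    -- For fixed w, the hypothesis `h` says precisely that v ↦ Ω(v, g w) − g Ω(v, w) commutes with
    -- g. It still maps ker φ₁(g) to ker φ₂(g), so it vanishes.
    have h0 : Ω.flip (g w) - g.comp (Ω.flip w) = 0 := by
      refine eq_zero_of_commute_of_spectralProj hc hg ?_ ?_ ?_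
      · ext v
        have := h v w
        simp only [mul_apply_eq_comp, sub_apply, ContinuousLinearMap.flip_apply,
          ContinuousLinearMap.comp_apply, map_sub]
        rw [← sub_eq_zero, ← this]
        abel
      · ext v
        simp [h₁]
      · ext v
        simp [h₃, hPg]
    simpa [sub_eq_zero] using DFunLike.congr_fun h0 v
  -- By `key`, Ω v itself now commutes with g, and the same principle applies a second time.
  have h0 : Ω v = 0 := by
    refine eq_zero_of_commute_of_spectralProj hc hg ?_ ?_ ?_
    · ext w
      simp [key]
    · ext w
      simp [h₂]
    · ext w
      simp [h₃]
  simp [h0]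

end BilinearIntertwining

/-! ### Smooth dependence of the spectral projection. -/

section SmoothProjection

variable {𝕜 : Type*} [RCLike 𝕜] {E V : Type*} [NormedAddCommGroup E] [NormedSpace 𝕜 E]
  [NormedAddCommGroup V] [NormedSpace 𝕜 V] [CompleteSpace V] {U : Set E}

omit [CompleteSpace V] in
theorem contDiffOn_aeval {g : E → V →L[𝕜] V} {φ : E → 𝕜[X]} {n : ℕ}
    (hg : ContDiffOn 𝕜 ∞ g U) (hφ : ∀ k, ContDiffOn 𝕜 ∞ (fun z => (φ z).coeff k) U)
    (hn : ∀ z ∈ U, (φ z).natDegree = n) :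
    ContDiffOn 𝕜 ∞ (fun z => Polynomial.aeval (g z) (φ z)) U := by
  have h : ContDiffOn 𝕜 ∞
      (fun z => ∑ i ∈ Finset.range (n + 1), (φ z).coeff i • g z ^ i) U :=
    ContDiffOn.sum fun i _ => (hφ i).smul (hg.pow i)
  exact h.congr fun z hz => by rw [Polynomial.aeval_eq_sum_range, hn z hz]

/-- Inversion is smooth at units, so the formula with an inverse settles the matter without
following Bézout coefficients as the polynomials vary. -/
theorem contDiffOn_spectralProj {g : E → V →L[𝕜] V} {φ₁ φ₂ : E → 𝕜[X]} {n₁ n₂ : ℕ}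
    (hg : ContDiffOn 𝕜 ∞ g U) (hφ₁ : ∀ k, ContDiffOn 𝕜 ∞ (fun z => (φ₁ z).coeff k) U)
    (hφ₂ : ∀ k, ContDiffOn 𝕜 ∞ (fun z => (φ₂ z).coeff k) U)
    (hn₁ : ∀ z ∈ U, (φ₁ z).natDegree = n₁) (hn₂ : ∀ z ∈ U, (φ₂ z).natDegree = n₂)
    (hc : ∀ z ∈ U, IsCoprime (φ₁ z) (φ₂ z))
    (h0 : ∀ z ∈ U, Polynomial.aeval (g z) (φ₁ z * φ₂ z) = 0) :
    ContDiffOn 𝕜 ∞ (fun z => spectralProj (φ₁ z) (φ₂ z) (g z)) U := by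
  have h1 := contDiffOn_aeval hg hφ₁ hn₁
  have h2 := contDiffOn_aeval hg hφ₂ hn₂
  refine ContDiffOn.mul (fun z hz => ?_) h2
  obtain ⟨u, hu⟩ := isUnit_aeval_add_aeval (hc z hz) (h0 z hz)
  refine ContDiffAt.comp_contDiffWithinAt (g := Ring.inverse) z ?_ ((h2.add h1) z hz)
  rw [← hu]
  exact contDiffAt_ringInverse 𝕜 u

end SmoothProjection

/-! ### Nijenhuis torsion and involutivity in a vector space. -/

section Torsion

variable {𝕜 : Type*} [NontriviallyNormedField 𝕜] {V : Type*} [NormedAddCommGroup V]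
  [NormedSpace 𝕜 V]

/-- The Nijenhuis torsion of a field of endomorphisms of a vector space, in coordinates. -/
noncomputable def linearTorsion (g : V → V →L[𝕜] V) (z v w : V) : V :=
  fderiv 𝕜 g z (g z v) w - fderiv 𝕜 g z (g z w) v + g z (fderiv 𝕜 g z w v)
    - g z (fderiv 𝕜 g z v w)

theorem fderiv_clm_apply_apply {E W : Type*} [NormedAddCommGroup E] [NormedSpace 𝕜 E]
    [NormedAddCommGroup W] [NormedSpace 𝕜 W] {g : E → V →L[𝕜] W} {X : E → V} {z : E}
    (hg : DifferentiableAt 𝕜 g z) (hX : DifferentiableAt 𝕜 X z) (u : E) :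
    fderiv 𝕜 (fun y => g y (X y)) z u = fderiv 𝕜 g z u (X z) + g z (fderiv 𝕜 X z u) := by
  rw [fderiv_clm_apply hg hX]
  simp [add_comm]

-- All derivatives of X and Y cancel. The torsion is thus tensorial and can be tested on constant
-- fields.
open VectorField in
theorem lieBracket_nijenhuis {g : V → V →L[𝕜] V} {X Y : V → V} {z : V}
    (hg : DifferentiableAt 𝕜 g z) (hX : DifferentiableAt 𝕜 X z) (hY : DifferentiableAt 𝕜 Y z) :
    lieBracket 𝕜 (fun y => g y (X y)) (fun y => g y (Y y)) z
      - g z (lieBracket 𝕜 (fun y => g y (X y)) Y z)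
      - g z (lieBracket 𝕜 X (fun y => g y (Y y)) z)
      + g z (g z (lieBracket 𝕜 X Y z)) = linearTorsion g z (X z) (Y z) := by
  simp only [lieBracket, fderiv_clm_apply_apply hg hX, fderiv_clm_apply_apply hg hY, linearTorsion,
    map_sub, map_add]
  abel

/-- The range of the field of projections `P` is involutive at `z`, in coordinates. -/
def IsInvolutiveAt (P : V → V →L[𝕜] V) (z : V) : Prop :=
  ∀ v w, P z (fderiv 𝕜 P z (P z v) (P z w) - fderiv 𝕜 P z (P z w) (P z v)) =
    fderiv 𝕜 P z (P z v) (P z w) - fderiv 𝕜 P z (P z w) (P z v)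

variable {P : V → V →L[𝕜] V} {z : V}

open VectorField in
/-- The Lie bracket of two sections of the range of `P` is tensorial modulo the range of `P`. -/
theorem sub_proj_lieBracket (hP : DifferentiableAt 𝕜 P z) (hid : P z * P z = P z)
    {X Y : V → V} (hX : DifferentiableAt 𝕜 X z) (hY : DifferentiableAt 𝕜 Y z)
    (hPX : (fun y => P y (X y)) =ᶠ[𝓝 z] X) (hPY : (fun y => P y (Y y)) =ᶠ[𝓝 z] Y) :
    lieBracket 𝕜 X Y z - P z (lieBracket 𝕜 X Y z) =
      (fderiv 𝕜 P z (X z) (Y z) - fderiv 𝕜 P z (Y z) (X z))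
        - P z (fderiv 𝕜 P z (X z) (Y z) - fderiv 𝕜 P z (Y z) (X z)) := by
  have hid' : ∀ u, P z (P z u) = P z u := fun u => DFunLike.congr_fun hid u
  -- Differentiating P Z = Z and applying 1 − P removes the derivative of Z from the right-hand
  -- side.
  have h : ∀ (Z : V → V), DifferentiableAt 𝕜 Z z → (fun y => P y (Z y)) =ᶠ[𝓝 z] Z → ∀ u,
      fderiv 𝕜 Z z u - P z (fderiv 𝕜 Z z u) =
        fderiv 𝕜 P z u (Z z) - P z (fderiv 𝕜 P z u (Z z)) := fun Z hZ hPZ u => by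
    have h1 : fderiv 𝕜 Z z u = fderiv 𝕜 P z u (Z z) + P z (fderiv 𝕜 Z z u) := by
      rw [← fderiv_clm_apply_apply hP hZ, hPZ.fderiv_eq]
    have h2 := congrArg (P z) h1
    rw [map_add, hid', right_eq_add] at h2
    rw [h2, sub_zero, sub_eq_iff_eq_add, ← h1]
  rw [lieBracket, map_sub, map_sub]
  have h1 := h X hX hPX (Y z)
  have h2 := h Y hY hPY (X z)
  calc _ = (fderiv 𝕜 Y z (X z) - P z (fderiv 𝕜 Y z (X z)))
      - (fderiv 𝕜 X z (Y z) - P z (fderiv 𝕜 X z (Y z))) := by abel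
    _ = _ := by rw [h1, h2]; abel

/-- The obstruction Ω to involutivity takes arguments in ker φ₁(g) and values in ker φ₂(g). As g
preserves the range of P, applying 1 − P to the torsion of the sections P v and P w gives the
quadratic relation of `bilinear_eq_zero_of_spectralProj`. -/
theorem isInvolutiveAt_spectralProj {g : V → V →L[𝕜] V} {φ₁ φ₂ : V → 𝕜[X]}
    (hg : DifferentiableAt 𝕜 g z)
    (hP : DifferentiableAt 𝕜 (fun y => spectralProj (φ₁ y) (φ₂ y) (g y)) z)
    (hc : ∀ᶠ y in 𝓝 z, IsCoprime (φ₁ y) (φ₂ y))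
    (h0 : ∀ᶠ y in 𝓝 z, Polynomial.aeval (g y) (φ₁ y * φ₂ y) = 0)
    (hN : ∀ v w, linearTorsion g z v w = 0) :
    IsInvolutiveAt (fun y => spectralProj (φ₁ y) (φ₂ y) (g y)) z := by
  set P : V → V →L[𝕜] V := fun y => spectralProj (φ₁ y) (φ₂ y) (g y) with hPdef
  have hid : ∀ᶠ y in 𝓝 z, P y * P y = P y := by
    filter_upwards [hc, h0] with y h1 h2 using spectralProj_mul_self h1 h2
  have hPg : ∀ y u, P y (g y u) = g y (P y u) := fun y u =>
    DFunLike.congr_fun (spectralProj_commute_self (φ₁ y) (φ₂ y) (g y)).eq u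
  have hidz : ∀ u, P z (P z u) = P z u := fun u => DFunLike.congr_fun hid.self_of_nhds u
  let T : V →L[𝕜] V →L[𝕜] V := (fderiv 𝕜 P z).bilinearComp (P z) (P z)
  let Ω : V →L[𝕜] V →L[𝕜] V :=
    (ContinuousLinearMap.compL 𝕜 V V V (ContinuousLinearMap.id 𝕜 V - P z)).comp (T - T.flip)
  have hΩ : ∀ v w, Ω v w = (fderiv 𝕜 P z (P z v) (P z w) - fderiv 𝕜 P z (P z w) (P z v))
      - P z (fderiv 𝕜 P z (P z v) (P z w) - fderiv 𝕜 P z (P z w) (P z v)) := fun v w => rfl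
  suffices h : ∀ v w, Ω v w = 0 by
    intro v w
    have := h v w
    rw [hΩ, sub_eq_zero] at this
    exact this.symm
  have hPΩ : ∀ v w, P z (Ω v w) = 0 := fun v w => by
    rw [hΩ, map_sub, hidz, sub_self]
  refine bilinear_eq_zero_of_spectralProj hc.self_of_nhds h0.self_of_nhds
    (fun v w => ?_) (fun v w => ?_) hPΩ fun v w => ?_
  · change Ω (P z v) w = _
    simp only [hΩ, hidz]
  · change Ω v (P z w) = _
    simp only [hΩ, hidz]
  · have hsec : ∀ (X Y : V → V), DifferentiableAt 𝕜 X z → DifferentiableAt 𝕜 Y z →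
        (fun y => P y (X y)) =ᶠ[𝓝 z] X → (fun y => P y (Y y)) =ᶠ[𝓝 z] Y →
        VectorField.lieBracket 𝕜 X Y z - P z (VectorField.lieBracket 𝕜 X Y z) =
          Ω (X z) (Y z) := fun X Y hX hY hPX hPY => by
      rw [sub_proj_lieBracket hP hid.self_of_nhds hX hY hPX hPY, hΩ,
        show P z (X z) = X z from hPX.self_of_nhds, show P z (Y z) = Y z from hPY.self_of_nhds]
    have hd : ∀ u, DifferentiableAt 𝕜 (fun y => P y u) z := fun u =>
      hP.clm_apply (differentiableAt_const u)
    have hdg : ∀ u, DifferentiableAt 𝕜 (fun y => g y (P y u)) z := fun u => hg.clm_apply (hd u)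
    have hs : ∀ u, (fun y => P y (P y u)) =ᶠ[𝓝 z] fun y => P y u := fun u => by
      filter_upwards [hid] with y hy using DFunLike.congr_fun hy u
    have hsg : ∀ u, (fun y => P y (g y (P y u))) =ᶠ[𝓝 z] fun y => g y (P y u) := fun u => by
      filter_upwards [hs u] with y hy
      rw [hPg, hy]
    have hT := lieBracket_nijenhuis hg (hd v) (hd w)
    rw [hN] at hT
    have hΩP : ∀ a b, Ω (P z a) b = Ω a b := fun a b => by simp only [hΩ, hidz]
    have hΩP' : ∀ a b, Ω a (P z b) = Ω a b := fun a b => by simp only [hΩ, hidz]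
    have e1 := hsec _ _ (hdg v) (hdg w) (hsg v) (hsg w)
    have e2 := hsec _ _ (hdg v) (hd w) (hsg v) (hs w)
    have e3 := hsec _ _ (hd v) (hdg w) (hs v) (hsg w)
    have e4 := hsec _ _ (hd v) (hd w) (hs v) (hs w)
    simp only [← hPg, hΩP, hΩP'] at e1 e2 e3 e4
    simp only [← hPg] at hT
    rw [← e1, ← e2, ← e3, ← e4]
    -- Subtracting this from `hT` amounts to applying 1 − P to the torsion.
    have hT' := congrArg (P z) hT
    simp only [map_add, map_sub, map_zero] at hT' ⊢
    simp only [hPg] at hT' hT ⊢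
    calc _ = _ := ?_
      _ = (0 : V) - 0 := congrArg₂ (· - ·) hT hT'
      _ = 0 := sub_zero _
    abel

end Torsion

/-! ### From involutive projections to product coordinates. -/

section InvolutiveGraph

universe u

/-- Conjugation by a continuous linear equivalence, as a continuous linear map. -/
noncomputable def ContinuousLinearEquiv.conjL {𝕜 : Type*} [NontriviallyNormedField 𝕜]
    {V V' : Type*} [NormedAddCommGroup V] [NormedSpace 𝕜 V] [NormedAddCommGroup V']
    [NormedSpace 𝕜 V'] (L : V ≃L[𝕜] V') : (V →L[𝕜] V) →L[𝕜] (V' →L[𝕜] V') :=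
  (ContinuousLinearMap.compL 𝕜 V' V V' (L : V →L[𝕜] V')).comp
    ((ContinuousLinearMap.compL 𝕜 V' V V).flip (L.symm : V' →L[𝕜] V))

@[simp]
theorem ContinuousLinearEquiv.conjL_apply {𝕜 : Type*} [NontriviallyNormedField 𝕜]
    {V V' : Type*} [NormedAddCommGroup V] [NormedSpace 𝕜 V] [NormedAddCommGroup V']
    [NormedSpace 𝕜 V'] (L : V ≃L[𝕜] V') (f : V →L[𝕜] V) (v : V') :
    L.conjL f v = L (f (L.symm v)) := rfl

theorem IsInvolutiveAt.conj {𝕜 : Type*} [NontriviallyNormedField 𝕜] {V V' : Type*}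
    [NormedAddCommGroup V] [NormedSpace 𝕜 V] [NormedAddCommGroup V'] [NormedSpace 𝕜 V']
    {P : V → V →L[𝕜] V} (L : V ≃L[𝕜] V') {z : V'} (hP : DifferentiableAt 𝕜 P (L.symm z))
    (h : IsInvolutiveAt P (L.symm z)) :
    IsInvolutiveAt (fun y => L.conjContinuousAlgEquiv (P (L.symm y))) z := by
  have hd : HasFDerivAt (fun y => L.conjContinuousAlgEquiv (P (L.symm y)))
      (L.conjL.comp ((fderiv 𝕜 P (L.symm z)).comp (L.symm : V' →L[𝕜] V))) z :=
    HasFDerivAt.comp z L.conjL.hasFDerivAt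
      (HasFDerivAt.comp z hP.hasFDerivAt L.symm.hasFDerivAt)
  intro v w
  rw [hd.fderiv]
  simpa using congrArg L (h (L.symm v) (L.symm w))

variable {𝕜 : Type*} [RCLike 𝕜]
  {A : Type u} [NormedAddCommGroup A] [NormedSpace 𝕜 A] [NormedSpace ℝ A] [IsScalarTower ℝ 𝕜 A]
  {B : Type u} [NormedAddCommGroup B] [NormedSpace 𝕜 B] [NormedSpace ℝ B] [IsScalarTower ℝ 𝕜 B]
  [CompleteSpace A] [CompleteSpace B]

/-- The Frobenius theorem for the range of a field of projections. -/
theorem exists_first_integral_of_isInvolutiveAt {Q : A × B → (A × B) →L[𝕜] (A × B)}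
    {U : Set (A × B)} (hU : IsOpen U) (h0 : (0 : A × B) ∈ U) (hQ : ContDiffOn 𝕜 ∞ Q U)
    (hid : ∀ z ∈ U, Q z * Q z = Q z) (hinv : ∀ z ∈ U, IsInvolutiveAt Q z)
    (hQ0 : ∀ v, Q 0 v = (0, v.2)) :
    ∃ (W : Set (A × B)) (ξ : A × B → A), IsOpen W ∧ 0 ∈ W ∧ W ⊆ U ∧ ContDiffOn 𝕜 ∞ ξ W ∧
      ξ 0 = 0 ∧ HasFDerivAt ξ (ContinuousLinearMap.fst 𝕜 A B) 0 ∧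
      ∀ z ∈ W, ∀ v, fderiv 𝕜 ξ z (Q z v) = 0 := by
  -- the blocks of `Q` and of `1 - Q` that are the identity at the origin
  let q : A × B → B →L[𝕜] B := fun z =>
    ((ContinuousLinearMap.snd 𝕜 A B).comp (Q z)).comp (ContinuousLinearMap.inr 𝕜 A B)
  let r : A × B → A →L[𝕜] A := fun z => 1 -
    ((ContinuousLinearMap.fst 𝕜 A B).comp (Q z)).comp (ContinuousLinearMap.inl 𝕜 A B)
  have hq : ContDiffOn 𝕜 ∞ q U := (contDiffOn_const.clm_comp hQ).clm_comp contDiffOn_const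
  have hr : ContDiffOn 𝕜 ∞ r U :=
    contDiffOn_const.sub ((contDiffOn_const.clm_comp hQ).clm_comp contDiffOn_const)
  let U' : Set (A × B) := (U ∩ q ⁻¹' {f | IsUnit f}) ∩ (U ∩ r ⁻¹' {f | IsUnit f})
  have hU' : IsOpen U' := (hq.continuousOn.isOpen_inter_preimage hU Units.isOpen).inter
    (hr.continuousOn.isOpen_inter_preimage hU Units.isOpen)
  have h0U' : (0 : A × B) ∈ U' := by
    have h1 : q 0 = 1 := by ext; simp [q, hQ0]
    have h2 : r 0 = 1 := by ext; simp [r, hQ0]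
    exact ⟨⟨h0, by simp [h1]⟩, h0, by simp [h2]⟩
  -- Q z maps 0 × B to a graph over B wherever its B-block is invertible.
  let F : A × B → B →L[𝕜] A := fun z => (((ContinuousLinearMap.fst 𝕜 A B).comp (Q z)).comp
    (ContinuousLinearMap.inr 𝕜 A B)).comp (Ring.inverse (q z))
  have hF : ContDiffOn 𝕜 ∞ F U' := by
    have hQ' : ContDiffOn 𝕜 ∞ Q U' := hQ.mono fun z hz => hz.1.1
    refine ((contDiffOn_const.clm_comp hQ').clm_comp contDiffOn_const).clm_comp fun z hz => ?_
    obtain ⟨u, hu⟩ := hz.1.2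
    refine ContDiffAt.comp_contDiffWithinAt (g := Ring.inverse) z ?_
      ((hq z hz.1.1).mono fun z hz => hz.1.1)
    rw [← hu]
    exact contDiffAt_ringInverse 𝕜 u
  have hmem : ∀ z ∈ U', ∀ w, Q z (F z w, w) = (F z w, w) := fun z hz w => by
    have h1 : (F z w, w) = Q z (0, Ring.inverse (q z) w) := by
      refine Prod.ext rfl ?_
      exact (DFunLike.congr_fun (Ring.mul_inverse_cancel _ hz.1.2) w).symm
    rw [h1]
    exact DFunLike.congr_fun (hid z hz.1.1) _
  -- Invertibility of r excludes nonzero vectors (a, 0) from the range of Q z, so that the graph of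
  -- F z is the whole range.
  have hzero : ∀ z ∈ U', ∀ a : A, Q z (a, 0) = (a, 0) → a = 0 := fun z hz a ha => by
    obtain ⟨u, hu⟩ := hz.2.2
    have h1 : r z a = 0 := by simp [r, ha]
    have h2 := DFunLike.congr_fun u.inv_mul a
    rw [hu] at h2
    simpa [h1] using h2.symm
  have hgraph : ∀ z ∈ U', ∀ v, Q z v = (F z (Q z v).2, (Q z v).2) := fun z hz v => by
    have h1 : (Q z v).1 - F z (Q z v).2 = 0 := by
      refine hzero z hz _ ?_
      have h2 : (((Q z v).1 - F z (Q z v).2, 0) : A × B) = Q z v - (F z (Q z v).2, (Q z v).2) := by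
        ext <;> simp
      rw [h2, map_sub, hmem z hz]
      congr 1
      exact DFunLike.congr_fun (hid z hz.1.1) v
    exact Prod.ext (sub_eq_zero.1 h1) rfl
  have hsymm : ∀ z ∈ U', ∀ v w : B,
      fderiv 𝕜 F z (F z v, v) w = fderiv 𝕜 F z (F z w, w) v := by
    intro z hz v w
    have hFd : DifferentiableAt 𝕜 F z :=
      (hF.contDiffAt (hU'.mem_nhds hz)).differentiableAt (by simp)
    have hQd : DifferentiableAt 𝕜 Q z :=
      (hQ.contDiffAt (hU.mem_nhds hz.1.1)).differentiableAt (by simp)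
    have hX : ∀ u : B, HasFDerivAt (fun y => (F y u, u))
        (((fderiv 𝕜 F z).flip u).prod (0 : (A × B) →L[𝕜] B)) z := fun u =>
      (hFd.hasFDerivAt.clm_apply (hasFDerivAt_const u z)).congr_fderiv (by simp) |>.prodMk
        (hasFDerivAt_const u z)
    have hs : ∀ u : B, (fun y => Q y (F y u, u)) =ᶠ[𝓝 z] fun y => (F y u, u) := fun u => by
      filter_upwards [hU'.mem_nhds hz] with y hy using hmem y hy u
    -- The sections (F v, v) and (F w, w) have constant B-components, so their bracket has the form
    -- (a, 0). By involutivity it lies in the range of Q, hence a = 0, which is the symmetry of the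
    -- derivative of F.
    have h1 := sub_proj_lieBracket hQd (hid z hz.1.1) (hX v).differentiableAt
      (hX w).differentiableAt (hs v) (hs w)
    have h2 := hinv z hz.1.1 (F z v, v) (F z w, w)
    rw [hmem z hz, hmem z hz] at h2
    rw [h2, sub_self] at h1
    simp only [VectorField.lieBracket, (hX v).fderiv, (hX w).fderiv] at h1
    refine sub_eq_zero.1 (hzero z hz _ ?_)
    rw [sub_eq_zero] at h1
    simpa using h1.symm
  obtain ⟨W, ξ, hW, h0W, hWU, hξ, hξ0, hd⟩ := exists_first_integral hU' h0U' hF hsymm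
  refine ⟨W, ξ, hW, h0W, fun z hz => (hWU hz).1.1, hξ, hξ0 0 h0W, ?_, fun z hz v => ?_⟩
  · have hξd : HasFDerivAt ξ (fderiv 𝕜 ξ 0) 0 :=
      ((hξ.contDiffAt (hW.mem_nhds h0W)).differentiableAt (by simp)).hasFDerivAt
    refine hξd.congr_fderiv ?_
    have h1 : (fderiv 𝕜 ξ 0).comp (ContinuousLinearMap.inl 𝕜 A B) = ContinuousLinearMap.id 𝕜 A := by
      have h2 : HasFDerivAt (fun x : A => (x, (0 : B))) (ContinuousLinearMap.inl 𝕜 A B) 0 :=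
        hasFDerivAt_prodMk_left 0 0
      have h3 := HasFDerivAt.comp (g := ξ) (f := fun x : A => (x, (0 : B))) 0 hξd h2
      refine h3.unique ((hasFDerivAt_id (0 : A)).congr_of_eventuallyEq ?_)
      filter_upwards [h2.continuousAt.preimage_mem_nhds (hW.mem_nhds h0W)] with x hx
      exact hξ0 x hx
    have hF0 : ∀ w, F 0 w = 0 := fun w => by simp [F, hQ0]
    ext v
    · exact DFunLike.congr_fun h1 v
    · simpa [hF0] using hd 0 h0W v
  · rw [hgraph z (hWU hz) v]
    exact hd z hz _

/-- A pair of complementary involutive distributions is locally a product foliation. -/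
theorem exists_product_coordinates {P : A × B → (A × B) →L[𝕜] (A × B)}
    {U : Set (A × B)} (hU : IsOpen U) (h0 : (0 : A × B) ∈ U) (hP : ContDiffOn 𝕜 ∞ P U)
    (hid : ∀ z ∈ U, P z * P z = P z) (hinv : ∀ z ∈ U, IsInvolutiveAt P z)
    (hinv' : ∀ z ∈ U, IsInvolutiveAt (fun y => 1 - P y) z)
    (hP0 : ∀ v, P 0 v = (v.1, 0)) :
    ∃ e : OpenPartialHomeomorph (A × B) (A × B), 0 ∈ e.source ∧ e.source ⊆ U ∧ e 0 = 0 ∧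
      ContDiffOn 𝕜 ∞ e e.source ∧ ContDiffOn 𝕜 ∞ e.symm e.target ∧
      ∀ z ∈ e.source, ∀ v, fderiv 𝕜 e z (P z v) = ((fderiv 𝕜 e z v).1, 0) := by
  have hid' : ∀ z ∈ U, (1 - P z) * (1 - P z) = 1 - P z := fun z hz => by
    simp [mul_sub, sub_mul, hid z hz]
  obtain ⟨W, ξ, hW, h0W, hWU, hξ, hξ0, hξd, hξP⟩ :=
    exists_first_integral_of_isInvolutiveAt hU h0 (contDiffOn_const.sub hP) hid' hinv'
      (fun v => by ext <;> simp [hP0])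
  -- Swapping the factors makes P, like 1 − P before, the projection to the second factor at the
  -- origin.
  let L : (A × B) ≃L[𝕜] (B × A) := ContinuousLinearEquiv.prodComm 𝕜 A B
  let Q : B × A → (B × A) →L[𝕜] (B × A) := fun z => L.conjContinuousAlgEquiv (P (L.symm z))
  have hQ : ContDiffOn 𝕜 ∞ Q (L.symm ⁻¹' U) :=
    L.conjL.contDiff.comp_contDiffOn (hP.comp L.symm.contDiff.contDiffOn fun z hz => hz)
  obtain ⟨W', η, hW', h0W', hWU', hη, hη0, hηd, hηP⟩ :=
    exists_first_integral_of_isInvolutiveAt (hU.preimage L.symm.continuous) (by simpa using h0) hQ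
      (fun z hz => by rw [← map_mul, hid _ hz]) (fun z hz => IsInvolutiveAt.conj L
        ((hP.contDiffAt (hU.mem_nhds hz)).differentiableAt (by simp)) (hinv _ hz))
      (fun v => by
        simp only [Q, ContinuousLinearEquiv.conjContinuousAlgEquiv_apply_apply, map_zero, hP0]
        rfl)
  -- The differential of ξ kills the kernel of P and that of η ∘ L kills its range, so dΘ carries P
  -- to the first projection.
  let Θ : A × B → A × B := fun z => (ξ z, η (L z))
  have hΘ : ContDiffOn 𝕜 ∞ Θ (W ∩ L ⁻¹' W') :=
    (hξ.mono inter_subset_left).prodMk (hη.comp L.contDiff.contDiffOn fun z hz => hz.2)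
  have hηL : ∀ z, L z ∈ W' → HasFDerivAt (fun z => η (L z))
      ((fderiv 𝕜 η (L z)).comp (L : (A × B) →L[𝕜] (B × A))) z := fun z hz =>
    HasFDerivAt.comp (g := η) z (((hη.contDiffAt (hW'.mem_nhds hz)).differentiableAt
      (by simp)).hasFDerivAt) L.hasFDerivAt
  have hΘd : HasFDerivAt Θ ((ContinuousLinearEquiv.refl 𝕜 (A × B) : (A × B) →L[𝕜] (A × B))) 0 := by
    have h1 := hηL 0 (by simpa using h0W')
    rw [map_zero, hηd.fderiv] at h1
    exact (hξd.prodMk h1).congr_fderiv (by ext <;> simp [L])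
  obtain ⟨e, he, h0e, heW, hes⟩ := hΘ.exists_openPartialHomeomorph
    (hW.inter (hW'.preimage L.continuous)) ⟨h0W, by simpa using h0W'⟩ hΘd
  refine ⟨e, h0e, fun z hz => hWU (heW hz).1, by rw [he]; simp [Θ, hξ0, hη0],
    by rw [he]; exact hΘ.mono heW, hes, fun z hz v => ?_⟩
  have hΘz : HasFDerivAt Θ ((fderiv 𝕜 ξ z).prod
      ((fderiv 𝕜 η (L z)).comp (L : (A × B) →L[𝕜] (B × A)))) z :=
    ((hξ.contDiffAt (hW.mem_nhds (heW hz).1)).differentiableAt (by simp)).hasFDerivAt.prodMk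
      (hηL z (heW hz).2)
  rw [he, hΘz.fderiv]
  have h1 := hξP z (heW hz).1 v
  have h2 := hηP (L z) (heW hz).2 (L v)
  refine Prod.ext ?_ ?_
  · simp only [ContinuousLinearMap.prod_apply]
    rw [sub_apply, map_sub, sub_eq_zero] at h1
    exact h1.symm
  · simpa [Q] using h2

end InvolutiveGraph

/-! ### Independence of each block from the other variables. -/

section ConstantProjection

variable {𝕜 : Type*} [NontriviallyNormedField 𝕜] {V : Type*} [NormedAddCommGroup V]
  [NormedSpace 𝕜 V]

/-- If the spectral projection of a torsion-free field of endomorphisms is constant, then the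
field on the range of the projection is constant along the kernel of the projection. -/
theorem proj_fderiv_eq_zero {g : V → V →L[𝕜] V} {z : V} {φ₁ φ₂ : 𝕜[X]} (hc : IsCoprime φ₁ φ₂)
    (h0 : Polynomial.aeval (g z) (φ₁ * φ₂) = 0) (hg : DifferentiableAt 𝕜 g z)
    (hN : ∀ v w, linearTorsion g z v w = 0) {π : V →L[𝕜] V}
    (hπ : spectralProj φ₁ φ₂ (g z) = π) (hcomm : ∀ᶠ y in 𝓝 z, Commute π (g y)) (v w : V) :
    π (fderiv 𝕜 g z (v - π v) (π w)) = 0 := by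
  have hπ' : ∀ u, π (π u) = π u := fun u => by
    rw [← hπ]; exact DFunLike.congr_fun (spectralProj_mul_self hc h0) u
  have hρ : spectralProj φ₂ φ₁ (g z) = 1 - π := by rw [spectralProj_swap hc h0, hπ]
  have hπg : ∀ u, π (g z u) = g z (π u) := fun u => DFunLike.congr_fun hcomm.self_of_nhds.eq u
  have hπg' : ∀ u x, π (fderiv 𝕜 g z u x) = fderiv 𝕜 g z u (π x) := fun u x => by
    have h1 : HasFDerivAt (fun y => π.comp (g y))
        ((ContinuousLinearMap.compL 𝕜 V V V π).comp (fderiv 𝕜 g z)) z :=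
      HasFDerivAt.comp z (ContinuousLinearMap.compL 𝕜 V V V π).hasFDerivAt hg.hasFDerivAt
    have h2 : HasFDerivAt (fun y => (g y).comp π)
        (((ContinuousLinearMap.compL 𝕜 V V V).flip π).comp (fderiv 𝕜 g z)) z :=
      HasFDerivAt.comp z ((ContinuousLinearMap.compL 𝕜 V V V).flip π).hasFDerivAt hg.hasFDerivAt
    have h3 := h1.unique (h2.congr_of_eventuallyEq
      (by filter_upwards [hcomm] with y hy using hy.eq))
    exact DFunLike.congr_fun (DFunLike.congr_fun h3 u) x
  let ψ : V →L[𝕜] V := π.comp (((fderiv 𝕜 g z).flip (π w)).comp (1 - π))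
  have hψ : ∀ u, ψ u = π (fderiv 𝕜 g z (u - π u) (π w)) := fun u => rfl
  suffices h : ψ = 0 by rw [← hψ, h]; rfl
  refine eq_zero_of_commute_of_spectralProj (φ₁ := φ₂) (φ₂ := φ₁) hc.symm
    (by rw [mul_comm, h0]) ?_ ?_ ?_
  · ext u
    simp only [mul_apply_eq_comp, hψ]
    -- As π commutes with every derivative of g, the torsion terms in which a derivative is applied
    -- to u − π u die under π. The remaining two terms say that ψ commutes with g.
    have h1 := congrArg π (hN (u - π u) (π w))
    simp only [linearTorsion, map_sub, map_add, map_zero, hπg, hπg', hπ', sub_self, sub_zero,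
      add_zero] at h1
    rw [sub_eq_zero] at h1
    simpa [hπg, hπg', hπ'] using h1
  · rw [hρ]
    ext u
    simp [hψ, hπ']
  · rw [hρ]
    ext u
    simp [hψ, hπ']

theorem eq_of_fderiv_snd_eq_zero {𝕜 : Type*} [RCLike 𝕜] {A B F : Type*} [NormedAddCommGroup A]
    [NormedSpace 𝕜 A] [NormedAddCommGroup B] [NormedSpace 𝕜 B] [NormedAddCommGroup F]
    [NormedSpace 𝕜 F] {a : A × B → F} {t : Set B} (ht : IsOpen t) (ht' : IsPreconnected t) {x : A}
    (ha : ∀ y ∈ t, DifferentiableAt 𝕜 a (x, y)) (h : ∀ y ∈ t, ∀ b, fderiv 𝕜 a (x, y) (0, b) = 0)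
    {y y' : B} (hy : y ∈ t) (hy' : y' ∈ t) : a (x, y) = a (x, y') := by
  have hd : ∀ y ∈ t, HasFDerivAt (fun y => a (x, y))
      ((fderiv 𝕜 a (x, y)).comp (ContinuousLinearMap.inr 𝕜 A B)) y := fun y hy =>
    HasFDerivAt.comp (g := a) y (ha y hy).hasFDerivAt (hasFDerivAt_prodMk_right x y)
  let _ : NormedSpace ℝ B := NormedSpace.restrictScalars ℝ 𝕜 B
  refine ht.is_const_of_fderiv_eq_zero (𝕜 := 𝕜) (f := fun y => a (x, y)) ht'
    (fun y hy => (hd y hy).differentiableAt.differentiableWithinAt) (fun y hy => ?_) hy hy'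
  rw [(hd y hy).fderiv]
  ext b
  exact h y hy b

theorem eq_of_fderiv_fst_eq_zero {𝕜 : Type*} [RCLike 𝕜] {A B F : Type*} [NormedAddCommGroup A]
    [NormedSpace 𝕜 A] [NormedAddCommGroup B] [NormedSpace 𝕜 B] [NormedAddCommGroup F]
    [NormedSpace 𝕜 F] {a : A × B → F} {t : Set A} (ht : IsOpen t) (ht' : IsPreconnected t) {y : B}
    (ha : ∀ x ∈ t, DifferentiableAt 𝕜 a (x, y)) (h : ∀ x ∈ t, ∀ b, fderiv 𝕜 a (x, y) (b, 0) = 0)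
    {x x' : A} (hx : x ∈ t) (hx' : x' ∈ t) : a (x, y) = a (x', y) := by
  have hd : ∀ x ∈ t, HasFDerivAt (fun x => a (x, y))
      ((fderiv 𝕜 a (x, y)).comp (ContinuousLinearMap.inl 𝕜 A B)) x := fun x hx =>
    HasFDerivAt.comp (g := a) x (ha x hx).hasFDerivAt (hasFDerivAt_prodMk_left x y)
  let _ : NormedSpace ℝ A := NormedSpace.restrictScalars ℝ 𝕜 A
  refine ht.is_const_of_fderiv_eq_zero (𝕜 := 𝕜) (f := fun x => a (x, y)) ht'
    (fun x hx => (hd x hx).differentiableAt.differentiableWithinAt) (fun x hx => ?_) hx hx'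
  rw [(hd x hx).fderiv]
  ext b
  exact h x hx b

end ConstantProjection

/-! ### Tensor fields and torsion in charts. -/

section Coordinates

variable {𝕜 : Type*} [RCLike 𝕜]
  {E : Type*} [NormedAddCommGroup E] [NormedSpace 𝕜 E]
  {M : Type*} [TopologicalSpace M] [ChartedSpace E M]
  {V : Type*} [NormedAddCommGroup V] [NormedSpace 𝕜 V]

/-- The expression of the tensor field `G` in the coordinates `e`. -/
noncomputable def TensorField11.inCoord (G : TensorField11 𝓘(𝕜, E) M)
    (e : OpenPartialHomeomorph M V) (v : V) : V →L[𝕜] V :=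
  ((mfderiv 𝓘(𝕜, V) 𝓘(𝕜, E) e.symm v).inverse.comp (G (e.symm v))).comp
    (mfderiv 𝓘(𝕜, V) 𝓘(𝕜, E) e.symm v)

variable {e : OpenPartialHomeomorph M V} {G : TensorField11 𝓘(𝕜, E) M}

theorem isInvertible_mfderiv_symm (he : e.MDifferentiable 𝓘(𝕜, E) 𝓘(𝕜, V)) {v : V}
    (hv : v ∈ e.target) : (mfderiv 𝓘(𝕜, V) 𝓘(𝕜, E) e.symm v).IsInvertible :=
  ⟨he.symm.mfderiv hv, rfl⟩

theorem TensorField11.mfderiv_symm_inCoord (he : e.MDifferentiable 𝓘(𝕜, E) 𝓘(𝕜, V)) {v : V}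
    (hv : v ∈ e.target) (w : V) :
    mfderiv 𝓘(𝕜, V) 𝓘(𝕜, E) e.symm v (G.inCoord e v w) =
      G (e.symm v) (mfderiv 𝓘(𝕜, V) 𝓘(𝕜, E) e.symm v w) := by
  have h := (isInvertible_mfderiv_symm he hv).self_comp_inverse
  exact DFunLike.congr_fun h (G (e.symm v) (mfderiv 𝓘(𝕜, V) 𝓘(𝕜, E) e.symm v w))

/-- The representative of the vector field `X` in the coordinates `e`. -/
noncomputable def VecField.inCoord (X : VecField 𝓘(𝕜, E) M) (e : OpenPartialHomeomorph M V) :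
    V → V :=
  VectorField.mpullback 𝓘(𝕜, V) 𝓘(𝕜, E) e.symm X

theorem VecField.inCoord_apply (X : VecField 𝓘(𝕜, E) M) (e : OpenPartialHomeomorph M V) (v : V) :
    X.inCoord e v = (mfderiv 𝓘(𝕜, V) 𝓘(𝕜, E) e.symm v).inverse (X (e.symm v)) := rfl

theorem VecField.inCoord_add (X Y : VecField 𝓘(𝕜, E) M) (e : OpenPartialHomeomorph M V) (v : V) :
    VecField.inCoord (X + Y) e v = X.inCoord e v + Y.inCoord e v :=
  map_add (mfderiv 𝓘(𝕜, V) 𝓘(𝕜, E) e.symm v).inverse _ _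

theorem VecField.inCoord_sub (X Y : VecField 𝓘(𝕜, E) M) (e : OpenPartialHomeomorph M V) (v : V) :
    VecField.inCoord (X - Y) e v = X.inCoord e v - Y.inCoord e v :=
  map_sub (mfderiv 𝓘(𝕜, V) 𝓘(𝕜, E) e.symm v).inverse _ _

theorem VecField.mfderiv_symm_inCoord (he : e.MDifferentiable 𝓘(𝕜, E) 𝓘(𝕜, V)) {v : V}
    (hv : v ∈ e.target) (X : VecField 𝓘(𝕜, E) M) :
    mfderiv 𝓘(𝕜, V) 𝓘(𝕜, E) e.symm v ((X.inCoord e : V → V) v) = X (e.symm v) :=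
  DFunLike.congr_fun (isInvertible_mfderiv_symm he hv).self_comp_inverse (X (e.symm v))

theorem TensorField11.inCoord_app (he : e.MDifferentiable 𝓘(𝕜, E) 𝓘(𝕜, V)) {v : V}
    (hv : v ∈ e.target) (X : VecField 𝓘(𝕜, E) M) :
    VecField.inCoord (G.app X) e v = G.inCoord e v (X.inCoord e v) := by
  have h : G.inCoord e v (X.inCoord e v) = (mfderiv 𝓘(𝕜, V) 𝓘(𝕜, E) e.symm v).inverse
    (G (e.symm v) (mfderiv 𝓘(𝕜, V) 𝓘(𝕜, E) e.symm v ((X.inCoord e : V → V) v))) := rfl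
  rw [h, VecField.mfderiv_symm_inCoord he hv]
  rfl

/-- The constant vector field `w` in the coordinates `e`. -/
noncomputable def coordField (e : OpenPartialHomeomorph M V) (w : V) : VecField 𝓘(𝕜, E) M :=
  VectorField.mpullback 𝓘(𝕜, E) 𝓘(𝕜, V) e fun _ => w

theorem coordField_apply (e : OpenPartialHomeomorph M V) (w : V) (x : M) :
    (coordField e w : VecField 𝓘(𝕜, E) M) x = (mfderiv 𝓘(𝕜, E) 𝓘(𝕜, V) e x).inverse w := rfl

theorem inCoord_coordField (he : e.MDifferentiable 𝓘(𝕜, E) 𝓘(𝕜, V)) {v : V}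
    (hv : v ∈ e.target) (w : V) :
    (coordField e w : VecField 𝓘(𝕜, E) M).inCoord e v = w := by
  have h1 : mfderiv 𝓘(𝕜, E) 𝓘(𝕜, V) e (e.symm v) (mfderiv 𝓘(𝕜, V) 𝓘(𝕜, E) e.symm v w) = w :=
    DFunLike.congr_fun (he.comp_symm_deriv hv) w
  have hi : (mfderiv 𝓘(𝕜, E) 𝓘(𝕜, V) e (e.symm v)).IsInvertible :=
    ⟨he.mfderiv (e.map_target hv), rfl⟩
  have h2 : (mfderiv 𝓘(𝕜, E) 𝓘(𝕜, V) e (e.symm v)).inverse w =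
      mfderiv 𝓘(𝕜, V) 𝓘(𝕜, E) e.symm v w := by
    conv_lhs => rw [← h1]
    exact DFunLike.congr_fun hi.inverse_comp_self (mfderiv 𝓘(𝕜, V) 𝓘(𝕜, E) e.symm v w)
  rw [VecField.inCoord_apply, coordField_apply]
  refine (congrArg _ h2).trans ?_
  exact DFunLike.congr_fun (isInvertible_mfderiv_symm he hv).inverse_comp_self w

variable [IsManifold 𝓘(𝕜, E) ∞ M]

theorem VecField.SmoothOn.mdifferentiableAt {X : VecField 𝓘(𝕜, E) M} {U : Set M}
    (hX : X.SmoothOn U) (hU : IsOpen U) {x : M} (hx : x ∈ U) :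
    MDifferentiableAt 𝓘(𝕜, E) 𝓘(𝕜, E).tangent
      (fun x => (⟨x, X x⟩ : TangentBundle 𝓘(𝕜, E) M)) x :=
  ((hX x hx).contMDiffAt (hU.mem_nhds hx)).mdifferentiableAt (by simp)

theorem TensorField11.Smooth.smoothOn_app (hG : G.Smooth) {X : VecField 𝓘(𝕜, E) M} {U : Set M}
    (hX : X.SmoothOn U) : (G.app X).SmoothOn U := by
  exact ContMDiffOn.clm_bundle_apply (F₁ := E) (F₂ := E) hG.contMDiffOn hX

theorem smoothOn_coordField [CompleteSpace E] (he : e.MDifferentiable 𝓘(𝕜, E) 𝓘(𝕜, V))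
    (hes : ContMDiffOn 𝓘(𝕜, E) 𝓘(𝕜, V) ∞ e e.source) (w : V) :
    (coordField e w : VecField 𝓘(𝕜, E) M).SmoothOn e.source := by
  intro x hx
  have h0 : ContMDiff 𝓘(𝕜, V) 𝓘(𝕜, V).tangent ∞
      (fun v : V => (⟨v, w⟩ : TangentBundle 𝓘(𝕜, V) V)) :=
    contMDiff_vectorSpace_iff_contDiff.2 contDiff_const
  exact (ContMDiffAt.mpullback_vectorField_preimage (m := ∞) (n := ∞)
    (h0 _) ((hes x hx).contMDiffAt (e.open_source.mem_nhds hx))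
    ⟨he.mfderiv hx, rfl⟩ (by simp)).contMDiffWithinAt

variable [CompleteSpace V]

theorem VecField.contDiffOn_inCoord (he : e.MDifferentiable 𝓘(𝕜, E) 𝓘(𝕜, V))
    (hes : ContMDiffOn 𝓘(𝕜, V) 𝓘(𝕜, E) ∞ e.symm e.target) {X : VecField 𝓘(𝕜, E) M}
    {U : Set M} (hU : IsOpen U) (hX : X.SmoothOn U) :
    ContDiffOn 𝕜 ∞ (X.inCoord e) (e.target ∩ e.symm ⁻¹' U) := by
  intro v hv
  have h1 := ContMDiffAt.mpullback_vectorField_preimage (m := ∞) (n := ∞)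
    ((hX (e.symm v) hv.2).contMDiffAt (hU.mem_nhds hv.2))
    ((hes v hv.1).contMDiffAt (e.open_target.mem_nhds hv.1))
    (isInvertible_mfderiv_symm he hv.1) (by simp)
  exact (contMDiffAt_vectorSpace_iff_contDiffAt.1 h1).contDiffWithinAt

theorem VecField.inCoord_mlieBracket [CompleteSpace E]
    (hes : ContMDiffOn 𝓘(𝕜, V) 𝓘(𝕜, E) ∞ e.symm e.target) {X Y : VecField 𝓘(𝕜, E) M}
    {U : Set M} (hU : IsOpen U) (hX : X.SmoothOn U) (hY : Y.SmoothOn U) {v : V}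
    (hv : v ∈ e.target) (hvU : e.symm v ∈ U) :
    VecField.inCoord (VectorField.mlieBracket 𝓘(𝕜, E) X Y) e v =
      VectorField.lieBracket 𝕜 (X.inCoord e) (Y.inCoord e) v := by
  have : IsManifold 𝓘(𝕜, E) (minSmoothness 𝕜 2) M := by
    rw [minSmoothness_of_isRCLikeNormedField]
    exact IsManifold.of_le (n := ∞) (by norm_cast)
  refine (VectorField.mpullback_mlieBracket (n := ∞) (hX.mdifferentiableAt hU hvU)
    (hY.mdifferentiableAt hU hvU) ((hes v hv).contMDiffAt (e.open_target.mem_nhds hv))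
    ?_).trans ?_
  · rw [minSmoothness_of_isRCLikeNormedField]
    norm_cast
  · rw [← VectorField.mlieBracketWithin_univ]
    refine (congrFun VectorField.mlieBracketWithin_eq_lieBracketWithin v).trans ?_
    exact congrFun VectorField.lieBracketWithin_univ v

/-- The Nijenhuis torsion in coordinates. -/
theorem inCoord_nijenhuis [CompleteSpace E] (hG : G.Smooth)
    (he : e.MDifferentiable 𝓘(𝕜, E) 𝓘(𝕜, V))
    (hes : ContMDiffOn 𝓘(𝕜, V) 𝓘(𝕜, E) ∞ e.symm e.target) {X Y : VecField 𝓘(𝕜, E) M}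
    {U : Set M} (hU : IsOpen U) (hX : X.SmoothOn U) (hY : Y.SmoothOn U) {v : V}
    (hv : v ∈ e.target) (hvU : e.symm v ∈ U) (hg : DifferentiableAt 𝕜 (G.inCoord e) v) :
    VecField.inCoord (G.nijenhuis X Y) e v =
      linearTorsion (G.inCoord e) v (X.inCoord e v) (Y.inCoord e v) := by
  have happ : ∀ X : VecField 𝓘(𝕜, E) M, VecField.inCoord (G.app X) e =ᶠ[𝓝 v]
      fun y => G.inCoord e y (X.inCoord e y) := fun X => by
    filter_upwards [e.open_target.mem_nhds hv] with y hy
    exact TensorField11.inCoord_app he hy X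
  have hdiff : ∀ {X : VecField 𝓘(𝕜, E) M}, X.SmoothOn U → DifferentiableAt 𝕜 (X.inCoord e) v :=
    fun hX => ((VecField.contDiffOn_inCoord he hes hU hX).contDiffAt
      ((hes.continuousOn.isOpen_inter_preimage e.open_target hU).mem_nhds
        ⟨hv, hvU⟩)).differentiableAt (by simp)
  have hb : ∀ {X Y : VecField 𝓘(𝕜, E) M}, X.SmoothOn U → Y.SmoothOn U →
      VecField.inCoord (VectorField.mlieBracket 𝓘(𝕜, E) X Y) e v =
        VectorField.lieBracket 𝕜 (X.inCoord e) (Y.inCoord e) v := fun hX hY =>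
    VecField.inCoord_mlieBracket hes hU hX hY hv hvU
  have hGX := hG.smoothOn_app hX
  have hGY := hG.smoothOn_app hY
  rw [TensorField11.nijenhuis, VecField.inCoord_add, VecField.inCoord_sub, VecField.inCoord_sub,
    TensorField11.inCoord_app he hv, TensorField11.inCoord_app he hv,
    TensorField11.inCoord_app he hv, TensorField11.inCoord_app he hv, hb hGX hGY, hb hGX hY,
    hb hX hGY, hb hX hY, (happ X).lieBracket_vectorField_eq (happ Y),
    (happ X).lieBracket_vectorField_eq EventuallyEq.rfl,
    EventuallyEq.rfl.lieBracket_vectorField_eq (happ Y),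
    lieBracket_nijenhuis hg (hdiff hX) (hdiff hY)]

variable [CompleteSpace E]

/-- In finite dimension smoothness can be tested on constant vectors, and these are the
representatives of the smooth fields `coordField e w`. -/
theorem contDiffOn_inCoord [FiniteDimensional 𝕜 V] (hG : G.Smooth)
    (he : ContMDiffOn 𝓘(𝕜, E) 𝓘(𝕜, V) ∞ e e.source)
    (hes : ContMDiffOn 𝓘(𝕜, V) 𝓘(𝕜, E) ∞ e.symm e.target) :
    ContDiffOn 𝕜 ∞ (G.inCoord e) e.target := by
  have hd : e.MDifferentiable 𝓘(𝕜, E) 𝓘(𝕜, V) :=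
    ⟨he.mdifferentiableOn (by simp), hes.mdifferentiableOn (by simp)⟩
  rw [contDiffOn_clm_apply]
  intro w
  have h1 := VecField.contDiffOn_inCoord hd hes e.open_source
    (hG.smoothOn_app (smoothOn_coordField hd he w))
  refine (h1.mono fun v hv => ⟨hv, e.map_target hv⟩).congr fun v hv => ?_
  rw [TensorField11.inCoord_app hd hv, inCoord_coordField hd hv]

theorem linearTorsion_inCoord [FiniteDimensional 𝕜 V] (hG : G.Smooth) (hN : G.TorsionFree)
    (he : ContMDiffOn 𝓘(𝕜, E) 𝓘(𝕜, V) ∞ e e.source)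
    (hes : ContMDiffOn 𝓘(𝕜, V) 𝓘(𝕜, E) ∞ e.symm e.target) {v : V} (hv : v ∈ e.target)
    (w w' : V) : linearTorsion (G.inCoord e) v w w' = 0 := by
  have hd : e.MDifferentiable 𝓘(𝕜, E) 𝓘(𝕜, V) :=
    ⟨he.mdifferentiableOn (by simp), hes.mdifferentiableOn (by simp)⟩
  have h := inCoord_nijenhuis hG hd hes e.open_source (smoothOn_coordField hd he w)
    (smoothOn_coordField hd he w') hv (e.map_target hv)
    (((contDiffOn_inCoord hG he hes).contDiffAt (e.open_target.mem_nhds hv)).differentiableAt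
      (by simp))
  rw [inCoord_coordField hd hv, inCoord_coordField hd hv] at h
  rw [← h, VecField.inCoord_apply, hN e.source e.open_source _ _
    (smoothOn_coordField hd he w) (smoothOn_coordField hd he w') _ (e.map_target hv), map_zero]
  rfl

/-- Tensoriality reduces the torsion at x, for arbitrary fields, to an identity at the single point
e x of one chart. -/
theorem torsionFree_of_linearTorsion_inCoord (hG : G.Smooth)
    (h : ∀ x : M, ∃ e : OpenPartialHomeomorph M V, x ∈ e.source ∧
      ContMDiffOn 𝓘(𝕜, E) 𝓘(𝕜, V) ∞ e e.source ∧
      ContMDiffOn 𝓘(𝕜, V) 𝓘(𝕜, E) ∞ e.symm e.target ∧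
      DifferentiableAt 𝕜 (G.inCoord e) (e x) ∧
      ∀ w w', linearTorsion (G.inCoord e) (e x) w w' = 0) : G.TorsionFree := by
  intro U hU X Y hX hY x hx
  obtain ⟨e, hxe, he, hes, hg, ht⟩ := h x
  have hd : e.MDifferentiable 𝓘(𝕜, E) 𝓘(𝕜, V) :=
    ⟨he.mdifferentiableOn (by simp), hes.mdifferentiableOn (by simp)⟩
  have hv := e.map_source hxe
  have hex : e.symm (e x) = x := e.left_inv hxe
  have h1 := inCoord_nijenhuis hG hd hes hU hX hY hv (by rwa [hex]) hg
  rw [ht] at h1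
  have h2 := VecField.mfderiv_symm_inCoord hd hv (G.nijenhuis X Y)
  rw [h1] at h2
  rw [← hex]
  exact h2.symm.trans (map_zero (mfderiv 𝓘(𝕜, V) 𝓘(𝕜, E) e.symm (e x)))

end Coordinates

/-! ### Tensor fields on open subsets of a vector space. -/

section OpenSubset

open TopologicalSpace

variable {𝕜 : Type*} [RCLike 𝕜] {V : Type*} [NormedAddCommGroup V] [NormedSpace 𝕜 V]
  {U : Opens V}

/-- The `(1,1)`-tensor field on an open subset `U` of `V` given by the function `a`. -/
def TensorField11.ofOpens (𝕜 : Type*) [RCLike 𝕜] {V : Type*} [NormedAddCommGroup V]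
    [NormedSpace 𝕜 V] (U : Opens V) (a : V → V →L[𝕜] V) : TensorField11 𝓘(𝕜, V) U :=
  fun x => a x

theorem hasMFDerivAt_opens_val (x : U) :
    HasMFDerivAt 𝓘(𝕜, V) 𝓘(𝕜, V) (Subtype.val : U → V) x (ContinuousLinearMap.id 𝕜 V) := by
  refine ⟨continuous_subtype_val.continuousAt, ?_⟩
  have h : ∀ᶠ y in 𝓝 (extChartAt 𝓘(𝕜, V) x x),
      writtenInExtChartAt 𝓘(𝕜, V) 𝓘(𝕜, V) x (Subtype.val : U → V) y = y := by
    filter_upwards [extChartAt_target_mem_nhds (I := 𝓘(𝕜, V)) x] with y hy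
    exact (extChartAt 𝓘(𝕜, V) x).right_inv hy
  exact ((hasFDerivAt_id _).congr_of_eventuallyEq h).hasFDerivWithinAt

/-- All charts of an open subset are the inclusion, so the tangent coordinate changes are trivial
and a tensor field is just an endomorphism-valued function. -/
theorem tangentBundleCore_coordChange_opens (x₀ x z : U) :
    (tangentBundleCore 𝓘(𝕜, V) U).coordChange (achart V x₀) (achart V x) z =
      ContinuousLinearMap.id 𝕜 V := by
  ext v
  refine tangentCoordChange_self (I := 𝓘(𝕜, V)) (x := x₀) ?_
  rw [extChartAt_source, Opens.chartAt_eq]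
  simp [chartAt_self_eq]

theorem inCoordinates_opens (x₀ x : U) (f : V →L[𝕜] V) :
    ContinuousLinearMap.inCoordinates V (TangentSpace 𝓘(𝕜, V) (M := U)) V
      (TangentSpace 𝓘(𝕜, V) (M := U)) x₀ x x₀ x f = f := by
  refine ((tangentBundleCore 𝓘(𝕜, V) U).inCoordinates_eq (tangentBundleCore 𝓘(𝕜, V) U) f
    ?_ ?_).trans ?_
  · simp [Opens.chartAt_eq, chartAt_self_eq]
  · simp [Opens.chartAt_eq, chartAt_self_eq]
  · simp only [tangentBundleCore_indexAt]
    rw [tangentBundleCore_coordChange_opens, tangentBundleCore_coordChange_opens]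
    rfl

theorem TensorField11.smooth_ofOpens {a : V → V →L[𝕜] V} (ha : ContDiffOn 𝕜 ∞ a U) :
    (TensorField11.ofOpens 𝕜 U a).Smooth := by
  intro x₀
  rw [contMDiffAt_hom_bundle]
  refine ⟨contMDiffAt_id, ?_⟩
  have h : ContMDiff 𝓘(𝕜, V) 𝓘(𝕜, V →L[𝕜] V) ∞ (fun x : U => a x) :=
    ha.contMDiffOn.comp_contMDiff contMDiff_subtype_val fun x => x.2
  refine (h x₀).congr_of_eventuallyEq (Eventually.of_forall fun x => ?_)
  exact inCoordinates_opens x₀ x (a x)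

variable [CompleteSpace V]

theorem TensorField11.torsionFree_ofOpens {a : V → V →L[𝕜] V} (ha : ContDiffOn 𝕜 ∞ a U)
    (ht : ∀ x ∈ U, ∀ v w, linearTorsion a x v w = 0) :
    (TensorField11.ofOpens 𝕜 U a).TorsionFree := by
  refine torsionFree_of_linearTorsion_inCoord (V := V) (smooth_ofOpens ha) fun x => ?_
  set e := U.openPartialHomeomorphSubtypeCoe ⟨x⟩ with he
  have hex : ∀ y : U, e y = y := fun y => rfl
  have het : e.target = U := U.openPartialHomeomorphSubtypeCoe_target ⟨x⟩
  have het' : ∀ y ∈ e.target, y ∈ U := fun y hy => by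
    have h := het ▸ hy
    exact h
  have hes : ∀ y ∈ U, (e.symm y : V) = y := fun y hy => e.right_inv (het ▸ hy)
  have h1 : ContMDiff 𝓘(𝕜, V) 𝓘(𝕜, V) ∞ e := contMDiff_subtype_val
  have h2 : ContMDiffOn 𝓘(𝕜, V) 𝓘(𝕜, V) ∞ e.symm e.target := fun y hy => by
    refine (ContMDiffWithinAt.subtypeVal_comp_iff U e.symm e.target y).1 ?_
    exact contMDiffWithinAt_id.congr (fun z hz => hes z (het' z hz)) (hes y (het' y hy))
  have hd : e.MDifferentiable 𝓘(𝕜, V) 𝓘(𝕜, V) :=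
    ⟨h1.contMDiffOn.mdifferentiableOn (by simp), h2.mdifferentiableOn (by simp)⟩
  have hG : ∀ y ∈ U, (TensorField11.ofOpens 𝕜 U a).inCoord e y = a y := by
    intro y hy
    have hy' : y ∈ e.target := het ▸ hy
    have h3 : mfderiv 𝓘(𝕜, V) 𝓘(𝕜, V) e (e.symm y) = ContinuousLinearMap.id 𝕜 V :=
      (hasMFDerivAt_opens_val (e.symm y)).mfderiv
    ext w
    have h4 : ∀ u : V, (mfderiv 𝓘(𝕜, V) 𝓘(𝕜, V) e.symm y u : V) = u := fun u => by
      refine Eq.trans ?_ (DFunLike.congr_fun (hd.comp_symm_deriv hy') u)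
      exact (DFunLike.congr_fun h3 _).symm
    refine (h4 _).symm.trans ((TensorField11.mfderiv_symm_inCoord hd hy' w).trans ?_)
    refine (congrArg (a (e.symm y)) (h4 w)).trans ?_
    rw [hes y hy]
  have hev : (TensorField11.ofOpens 𝕜 U a).inCoord e =ᶠ[𝓝 (x : V)] a := by
    filter_upwards [U.isOpen.mem_nhds x.2] with y hy using hG y hy
  refine ⟨e, mem_univ _, h1.contMDiffOn, h2, ?_, fun w w' => ?_⟩
  · exact (((ha.contDiffAt (U.isOpen.mem_nhds x.2)).differentiableAt (by simp)).congr_of_eventuallyEq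
      hev)
  · rw [← ht x x.2 w w']
    simp only [linearTorsion, hex, hev.fderiv_eq, hev.eq_of_nhds]

end OpenSubset

/-! ### Block decomposition of a single endomorphism. -/

section Blocks

/-- `Ring.inverse` is zero off the units and need not commute with F there; the hypotheses ensure
that the inverse is genuine. -/
theorem spectralProj_map {𝕜 : Type*} [Field 𝕜] {R R' : Type*} [Ring R] [Algebra 𝕜 R] [Ring R']
    [Algebra 𝕜 R'] (F : R →ₐ[𝕜] R') {φ₁ φ₂ : 𝕜[X]} {g : R} (hc : IsCoprime φ₁ φ₂)
    (hg : Polynomial.aeval g (φ₁ * φ₂) = 0) :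
    spectralProj φ₁ φ₂ (F g) = F (spectralProj φ₁ φ₂ g) := by
  obtain ⟨u, hu⟩ := isUnit_aeval_add_aeval hc hg
  have h : Polynomial.aeval (F g) φ₂ + Polynomial.aeval (F g) φ₁ = Units.map (F : R →* R') u := by
    simp [hu, Polynomial.aeval_algHom_apply]
  rw [spectralProj, spectralProj, h, ← hu, Ring.inverse_unit, Ring.inverse_unit, map_mul,
    Polynomial.aeval_algHom_apply]
  rfl

variable {𝕜 : Type*} [NontriviallyNormedField 𝕜] {V A B : Type*}
  [NormedAddCommGroup V] [NormedSpace 𝕜 V]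
  [NormedAddCommGroup A] [NormedSpace 𝕜 A] [NormedAddCommGroup B] [NormedSpace 𝕜 B]

theorem aeval_apply_of_semiconj {g : V →L[𝕜] V} {a : A →ₗ[𝕜] A} {i : A →ₗ[𝕜] V}
    (h : ∀ x, g (i x) = i (a x)) (p : 𝕜[X]) (x : A) :
    Polynomial.aeval g p (i x) = i (Polynomial.aeval a p x) := by
  have hpow : ∀ (n : ℕ) (x : A), (g ^ n) (i x) = i ((a ^ n) x) := fun n => by
    induction n with
    | zero => intro x; simp
    | succ n ih => intro x; simp [pow_succ, h, ih]
  induction p using Polynomial.induction_on' with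
  | add p q hp hq => simp [hp, hq]
  | monomial n c => simp [Polynomial.aeval_monomial, Algebra.algebraMap_eq_smul_one, hpow]

theorem aeval_eq_zero_of_charpoly [FiniteDimensional 𝕜 V] {g : V →L[𝕜] V} {p : 𝕜[X]}
    (h : LinearMap.charpoly (g : V →ₗ[𝕜] V) = p) : Polynomial.aeval g p = 0 := by
  ext v
  have h1 := aeval_apply_of_semiconj (g := g) (a := (g : V →ₗ[𝕜] V)) (i := LinearMap.id)
    (fun _ => rfl) p v
  rw [← h, LinearMap.aeval_self_charpoly] at h1
  rw [← h]
  exact h1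

/-- An endomorphism whose spectral projection is the first projection of a product splits, and the
two factors of its characteristic polynomial are those of the blocks. -/
theorem blocks_of_spectralProj [FiniteDimensional 𝕜 A] [FiniteDimensional 𝕜 B]
    {g : A × B →L[𝕜] A × B} {φ₁ φ₂ : 𝕜[X]} (hc : IsCoprime φ₁ φ₂) (hφ : φ₁.Monic)
    (hchar : LinearMap.charpoly (g : A × B →ₗ[𝕜] A × B) = φ₁ * φ₂)
    (hP : ∀ v, spectralProj φ₁ φ₂ g v = (v.1, 0)) {a : A →L[𝕜] A} {b : B →L[𝕜] B}
    (ha : ∀ x, a x = (g (x, 0)).1) (hb : ∀ y, b y = (g (0, y)).2) :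
    (∀ v, g v = (a v.1, b v.2)) ∧ LinearMap.charpoly (a : A →ₗ[𝕜] A) = φ₁ ∧
      LinearMap.charpoly (b : B →ₗ[𝕜] B) = φ₂ := by
  have h0 := aeval_eq_zero_of_charpoly hchar
  have hcomm : ∀ v, ((g v).1, (0 : B)) = g (v.1, 0) := fun v => by
    rw [← hP, ← hP]
    exact DFunLike.congr_fun (spectralProj_commute_self φ₁ φ₂ g).eq v
  have hga : ∀ x, g (x, 0) = (a x, 0) := fun x => by
    rw [ha, ← hcomm (x, 0)]
  have hgb : ∀ y, g (0, y) = (0, b y) := fun y => by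
    have h := congrArg Prod.fst (hcomm (0, y))
    simp only [Prod.mk_zero_zero, map_zero, Prod.fst_zero] at h
    exact Prod.ext h (hb y).symm
  have hg : ∀ v, g v = (a v.1, b v.2) := fun v => by
    have h : v = (v.1, 0) + (0, v.2) := by simp
    rw [h, map_add, hga, hgb]
    simp
  have hA : Polynomial.aeval (a : A →ₗ[𝕜] A) φ₁ = 0 := by
    ext x
    have h1 := aeval_apply_of_semiconj (g := g) (a := (a : A →ₗ[𝕜] A))
      (i := LinearMap.inl 𝕜 A B) hga φ₁ x
    have h2 := DFunLike.congr_fun (aeval_mul_spectralProj h0) (x, 0)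
    rw [mul_apply_eq_comp, hP] at h2
    exact congrArg Prod.fst (h1.symm.trans h2)
  have h0' : Polynomial.aeval g (φ₂ * φ₁) = 0 := by rw [mul_comm, h0]
  have hB : Polynomial.aeval (b : B →ₗ[𝕜] B) φ₂ = 0 := by
    ext y
    have h1 := aeval_apply_of_semiconj (g := g) (a := (b : B →ₗ[𝕜] B))
      (i := LinearMap.inr 𝕜 A B) hgb φ₂ y
    have h2 := DFunLike.congr_fun (aeval_mul_spectralProj h0') (0, y)
    rw [mul_apply_eq_comp, spectralProj_swap hc h0, sub_apply, hP] at h2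
    simp only [one_apply_eq_self, Prod.mk_zero_zero, sub_zero] at h2
    exact congrArg Prod.snd (h1.symm.trans h2)
  refine ⟨hg, LinearMap.charpoly_eq_of_mul_eq hc hφ hA hB ?_⟩
  rw [← hchar, ← LinearMap.charpoly_prodMap]
  congr 1
  ext v <;> simp [hg]

theorem charpoly_conjContinuousAlgEquiv [FiniteDimensional 𝕜 V] [FiniteDimensional 𝕜 A]
    (L : V ≃L[𝕜] A) (g : V →L[𝕜] V) :
    LinearMap.charpoly (L.conjContinuousAlgEquiv g : A →ₗ[𝕜] A) =
      LinearMap.charpoly (g : V →ₗ[𝕜] V) :=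
  L.toLinearEquiv.charpoly_conj (g : V →ₗ[𝕜] V)

theorem spectralProj_conjContinuousAlgEquiv (L : V ≃L[𝕜] A) {φ₁ φ₂ : 𝕜[X]} {g : V →L[𝕜] V}
    (hc : IsCoprime φ₁ φ₂) (hg : Polynomial.aeval g (φ₁ * φ₂) = 0) :
    spectralProj φ₁ φ₂ (L.conjContinuousAlgEquiv g) =
      L.conjContinuousAlgEquiv (spectralProj φ₁ φ₂ g) :=
  spectralProj_map (L.conjContinuousAlgEquiv.toAlgEquiv : (V →L[𝕜] V) →ₐ[𝕜] (A →L[𝕜] A)) hc hg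

/-- The spectral projection is the first projection in suitable linear coordinates. -/
theorem exists_equiv_spectralProj [CompleteSpace 𝕜] [FiniteDimensional 𝕜 V] [FiniteDimensional 𝕜 A]
    [FiniteDimensional 𝕜 B] {g : V →L[𝕜] V} {φ₁ φ₂ : 𝕜[X]} (hc : IsCoprime φ₁ φ₂)
    (hφ : φ₁.Monic) (hchar : LinearMap.charpoly (g : V →ₗ[𝕜] V) = φ₁ * φ₂)
    (hA : φ₁.natDegree = Module.finrank 𝕜 A) (hB : φ₂.natDegree = Module.finrank 𝕜 B) :
    ∃ L : V ≃L[𝕜] A × B, ∀ v, L (spectralProj φ₁ φ₂ g v) = ((L v).1, 0) := by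
  have h0 := aeval_eq_zero_of_charpoly hchar
  set P : V →L[𝕜] V := spectralProj φ₁ φ₂ g with hP
  have hid : IsIdempotentElem (P : V →ₗ[𝕜] V) := by
    ext v
    exact DFunLike.congr_fun (spectralProj_mul_self hc h0) v
  let D₁ := LinearMap.range (P : V →ₗ[𝕜] V)
  let D₂ := LinearMap.ker (P : V →ₗ[𝕜] V)
  let L₀ : V ≃L[𝕜] D₁ × D₂ :=
    (D₁.prodEquivOfIsCompl D₂ (LinearMap.IsIdempotentElem.isCompl hid)).symm.toContinuousLinearEquiv
  have hL₀s : ∀ w, L₀.symm w = w.1 + w.2 := fun w => rfl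
  have hL₀ : ∀ v, L₀ (P v) = ((L₀ v).1, 0) := fun v => by
    obtain ⟨w, rfl⟩ := L₀.symm.surjective v
    rw [L₀.apply_symm_apply, ← L₀.eq_symm_apply, hL₀s, hL₀s, map_add]
    obtain ⟨⟨_, u, rfl⟩, ⟨y, hy⟩⟩ := w
    have h1 : P (P u) = P u := DFunLike.congr_fun hid u
    have h2 : P y = 0 := hy
    simp [h1, h2]
  let g' : D₁ × D₂ →L[𝕜] D₁ × D₂ := L₀.conjContinuousAlgEquiv g
  -- The blocks on the range and on the kernel have characteristic polynomials φ₁ and φ₂, whose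
  -- degrees give the dimensions of these subspaces.
  obtain ⟨-, h1, h2⟩ := blocks_of_spectralProj (g := g') hc hφ
    ((charpoly_conjContinuousAlgEquiv L₀ g).trans hchar)
    (fun v => by
      rw [spectralProj_conjContinuousAlgEquiv L₀ hc h0,
        ContinuousLinearEquiv.conjContinuousAlgEquiv_apply_apply, hL₀, L₀.apply_symm_apply])
    (a := ((ContinuousLinearMap.fst 𝕜 D₁ D₂).comp g').comp (ContinuousLinearMap.inl 𝕜 D₁ D₂))
    (b := ((ContinuousLinearMap.snd 𝕜 D₁ D₂).comp g').comp (ContinuousLinearMap.inr 𝕜 D₁ D₂))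
    (fun _ => rfl) (fun _ => rfl)
  rw [← h1, LinearMap.charpoly_natDegree] at hA
  rw [← h2, LinearMap.charpoly_natDegree] at hB
  refine ⟨L₀.trans ((ContinuousLinearEquiv.ofFinrankEq hA).prodCongr
    (ContinuousLinearEquiv.ofFinrankEq hB)), fun v => ?_⟩
  simp [hL₀]

end Blocks

/-! ### Splitting a field whose spectral projection is constant. -/

section ProductForm

variable {𝕜 : Type*} [NontriviallyNormedField 𝕜] {V A : Type*}
  [NormedAddCommGroup V] [NormedSpace 𝕜 V] [NormedAddCommGroup A] [NormedSpace 𝕜 A]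

/-- The maps i and q intertwine a with g, so each term of the torsion restricts to the slice.
Torsion-freeness of g thereby passes to its blocks. -/
theorem linearTorsion_block {g : V → V →L[𝕜] V} {a : A → A →L[𝕜] A} (i : A →L[𝕜] V)
    (q : V →L[𝕜] A) {x : A} (hg : DifferentiableAt 𝕜 g (i x))
    (ha : a =ᶠ[𝓝 x] fun x => (q.comp (g (i x))).comp i)
    (h1 : ∀ v, g (i x) (i v) = i (a x v)) (h2 : ∀ u, q (g (i x) u) = a x (q u)) (v w : A) :
    linearTorsion a x v w = q (linearTorsion g (i x) (i v) (i w)) := by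
  let T : (V →L[𝕜] V) →L[𝕜] (A →L[𝕜] A) :=
    ((ContinuousLinearMap.compL 𝕜 A V A).flip i).comp (ContinuousLinearMap.compL 𝕜 V V A q)
  have hd : HasFDerivAt a (T.comp ((fderiv 𝕜 g (i x)).comp i)) x :=
    (HasFDerivAt.comp x T.hasFDerivAt
      (HasFDerivAt.comp x hg.hasFDerivAt i.hasFDerivAt)).congr_of_eventuallyEq ha
  have hd' : ∀ u w, fderiv 𝕜 a x u w = q (fderiv 𝕜 g (i x) (i u) (i w)) := fun u w => by
    rw [hd.fderiv]; rfl
  simp only [linearTorsion, hd', h1, map_sub, map_add, h2]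

end ProductForm

section ProductForm

variable {𝕜 : Type*} [RCLike 𝕜] {A B : Type*} [NormedAddCommGroup A] [NormedSpace 𝕜 A]
  [NormedAddCommGroup B] [NormedSpace 𝕜 B] [FiniteDimensional 𝕜 A] [FiniteDimensional 𝕜 B]

/-- A torsion-free field of endomorphisms of a product whose spectral projection is the first
projection is locally a product of torsion-free fields. -/
theorem exists_product_form {g : A × B → (A × B) →L[𝕜] (A × B)} {W : Set (A × B)} (hW : IsOpen W)
    (h0W : 0 ∈ W) (hg : ContDiffOn 𝕜 ∞ g W) (hN : ∀ z ∈ W, ∀ v w, linearTorsion g z v w = 0)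
    {φ₁ φ₂ : A × B → 𝕜[X]} (hc : ∀ z ∈ W, IsCoprime (φ₁ z) (φ₂ z)) (hφ : ∀ z ∈ W, (φ₁ z).Monic)
    (hchar : ∀ z ∈ W, LinearMap.charpoly (g z : A × B →ₗ[𝕜] A × B) = φ₁ z * φ₂ z)
    (hP : ∀ z ∈ W, ∀ v, spectralProj (φ₁ z) (φ₂ z) (g z) v = (v.1, 0)) :
    ∃ r > 0, Metric.ball 0 r ×ˢ Metric.ball 0 r ⊆ W ∧ ∃ (a : A → A →L[𝕜] A) (b : B → B →L[𝕜] B),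
      ContDiffOn 𝕜 ∞ a (Metric.ball 0 r) ∧ ContDiffOn 𝕜 ∞ b (Metric.ball 0 r) ∧
      (∀ x ∈ Metric.ball 0 r, ∀ v w, linearTorsion a x v w = 0) ∧
      (∀ y ∈ Metric.ball 0 r, ∀ v w, linearTorsion b y v w = 0) ∧
      ∀ x ∈ Metric.ball 0 r, ∀ y ∈ Metric.ball 0 r,
        (∀ v, g (x, y) v = (a x v.1, b y v.2)) ∧
        LinearMap.charpoly (a x : A →ₗ[𝕜] A) = φ₁ (x, y) ∧
        LinearMap.charpoly (b y : B →ₗ[𝕜] B) = φ₂ (x, y) := by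
  -- In the sup norm a ball of the product is a product of balls; their convexity later turns a zero
  -- partial derivative into constancy.
  obtain ⟨r, hr, hrW⟩ := Metric.isOpen_iff.1 hW 0 h0W
  have hball : Metric.ball (0 : A) r ×ˢ Metric.ball (0 : B) r ⊆ W := by
    rw [ball_prod_same]; exact hrW
  have hA : IsPreconnected (Metric.ball (0 : A) r) := by
    let _ : NormedSpace ℝ A := NormedSpace.restrictScalars ℝ 𝕜 A
    exact (convex_ball 0 r).isPreconnected
  have hB : IsPreconnected (Metric.ball (0 : B) r) := by
    let _ : NormedSpace ℝ B := NormedSpace.restrictScalars ℝ 𝕜 B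
    exact (convex_ball 0 r).isPreconnected
  let iA := ContinuousLinearMap.inl 𝕜 A B
  let iB := ContinuousLinearMap.inr 𝕜 A B
  let qA := ContinuousLinearMap.fst 𝕜 A B
  let qB := ContinuousLinearMap.snd 𝕜 A B
  let TA : ((A × B) →L[𝕜] (A × B)) →L[𝕜] (A →L[𝕜] A) :=
    ((ContinuousLinearMap.compL 𝕜 A (A × B) A).flip iA).comp
      (ContinuousLinearMap.compL 𝕜 (A × B) (A × B) A qA)
  let TB : ((A × B) →L[𝕜] (A × B)) →L[𝕜] (B →L[𝕜] B) :=
    ((ContinuousLinearMap.compL 𝕜 B (A × B) B).flip iB).comp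
      (ContinuousLinearMap.compL 𝕜 (A × B) (A × B) B qB)
  let a : A × B → A →L[𝕜] A := fun z => TA (g z)
  let b : A × B → B →L[𝕜] B := fun z => TB (g z)
  have hblocks : ∀ z ∈ W, (∀ v, g z v = (a z v.1, b z v.2)) ∧
      LinearMap.charpoly (a z : A →ₗ[𝕜] A) = φ₁ z ∧
      LinearMap.charpoly (b z : B →ₗ[𝕜] B) = φ₂ z := fun z hz =>
    blocks_of_spectralProj (hc z hz) (hφ z hz) (hchar z hz) (hP z hz) (fun _ => rfl) (fun _ => rfl)
  have hgd : ∀ z ∈ W, DifferentiableAt 𝕜 g z := fun z hz =>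
    (hg.contDiffAt (hW.mem_nhds hz)).differentiableAt (by simp)
  have had : ∀ z ∈ W, HasFDerivAt a (TA.comp (fderiv 𝕜 g z)) z := fun z hz =>
    HasFDerivAt.comp z TA.hasFDerivAt (hgd z hz).hasFDerivAt
  have hbd : ∀ z ∈ W, HasFDerivAt b (TB.comp (fderiv 𝕜 g z)) z := fun z hz =>
    HasFDerivAt.comp z TB.hasFDerivAt (hgd z hz).hasFDerivAt
  let π : A × B →L[𝕜] A × B := iA.comp qA
  have hπ : ∀ z ∈ W, spectralProj (φ₁ z) (φ₂ z) (g z) = π := fun z hz => by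
    ext v <;> simp [hP z hz, π, iA, qA]
  have h0 : ∀ z ∈ W, Polynomial.aeval (g z) (φ₁ z * φ₂ z) = 0 := fun z hz =>
    aeval_eq_zero_of_charpoly (hchar z hz)
  have hcomm : ∀ z ∈ W, Commute π (g z) := fun z hz => by
    rw [← hπ z hz]; exact spectralProj_commute_self _ _ _
  have hda : ∀ z ∈ W, ∀ y, fderiv 𝕜 a z (0, y) = 0 := fun z hz y => by
    rw [(had z hz).fderiv]
    ext w
    have h := proj_fderiv_eq_zero (hc z hz) (h0 z hz) (hgd z hz) (hN z hz) (hπ z hz)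
      (by filter_upwards [hW.mem_nhds hz] with y hy using hcomm y hy) (0, y) (w, 0)
    have h' := congrArg Prod.fst h
    simpa [π, iA, qA, TA] using h'
  have hdb : ∀ z ∈ W, ∀ x, fderiv 𝕜 b z (x, 0) = 0 := fun z hz x => by
    rw [(hbd z hz).fderiv]
    ext w
    -- With φ₁ and φ₂ exchanged the constant projection is 1 − π.
    have h := proj_fderiv_eq_zero (hc z hz).symm (by rw [mul_comm, h0 z hz]) (hgd z hz) (hN z hz)
      ((spectralProj_swap (hc z hz) (h0 z hz)).trans (by rw [hπ z hz]))
      (by filter_upwards [hW.mem_nhds hz] with y hy using (Commute.one_left _).sub_left (hcomm y hy))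
      (x, 0) (0, w)
    have h' := congrArg Prod.snd h
    simpa [π, iA, qA, iB, qB, TB] using h'
  have hconsta : ∀ x ∈ Metric.ball (0 : A) r, ∀ y ∈ Metric.ball (0 : B) r, a (x, y) = a (x, 0) :=
    fun x hx y hy => eq_of_fderiv_snd_eq_zero Metric.isOpen_ball hB
      (fun y hy => (had _ (hball ⟨hx, hy⟩)).differentiableAt)
      (fun y hy b => hda _ (hball ⟨hx, hy⟩) b) hy (Metric.mem_ball_self hr)
  have hconstb : ∀ x ∈ Metric.ball (0 : A) r, ∀ y ∈ Metric.ball (0 : B) r, b (x, y) = b (0, y) :=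
    fun x hx y hy => eq_of_fderiv_fst_eq_zero Metric.isOpen_ball hA
      (fun x hx => (hbd _ (hball ⟨hx, hy⟩)).differentiableAt)
      (fun x hx v => hdb _ (hball ⟨hx, hy⟩) v) hx (Metric.mem_ball_self hr)
  have hmemA : ∀ x ∈ Metric.ball (0 : A) r, (x, (0 : B)) ∈ W := fun x hx =>
    hball ⟨hx, Metric.mem_ball_self hr⟩
  have hmemB : ∀ y ∈ Metric.ball (0 : B) r, ((0 : A), y) ∈ W := fun y hy =>
    hball ⟨Metric.mem_ball_self hr, hy⟩
  refine ⟨r, hr, hball, fun x => a (x, 0), fun y => b (0, y), ?_, ?_, fun x hx v w => ?_,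
    fun y hy v w => ?_, fun x hx y hy => ?_⟩
  · exact TA.contDiff.comp_contDiffOn (hg.comp (contDiff_id.prodMk contDiff_const).contDiffOn hmemA)
  · exact TB.contDiff.comp_contDiffOn (hg.comp (contDiff_const.prodMk contDiff_id).contDiffOn hmemB)
  · have hzW : iA x ∈ W := hmemA x hx
    rw [linearTorsion_block (g := g) (a := fun x => a (x, 0)) iA qA (hgd _ hzW)
      (Eventually.of_forall fun u => rfl)
      (fun v => ?_) (fun u => ?_), hN _ hzW, map_zero]
    · refine ((hblocks _ hzW).1 _).trans ?_; simp [iA]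
    · change (g (iA x) u).1 = a (iA x) u.1
      rw [(hblocks _ hzW).1]
  · have hzW : iB y ∈ W := hmemB y hy
    rw [linearTorsion_block (g := g) (a := fun y => b (0, y)) iB qB (hgd _ hzW)
      (Eventually.of_forall fun u => rfl)
      (fun v => ?_) (fun u => ?_), hN _ hzW, map_zero]
    · refine ((hblocks _ hzW).1 _).trans ?_; simp [iB]
    · change (g (iB y) u).2 = b (iB y) u.2
      rw [(hblocks _ hzW).1]
  · obtain ⟨h1, h2, h3⟩ := hblocks (x, y) (hball ⟨hx, hy⟩)
    rw [hconsta x hx y hy] at h1 h2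
    rw [hconstb x hx y hy] at h1 h3
    exact ⟨h1, h2, h3⟩

end ProductForm

/-! ### Charts adapted to the spectral splitting. -/

section AdaptedChart

variable {𝕜 : Type*} [RCLike 𝕜]
  {E : Type*} [NormedAddCommGroup E] [NormedSpace 𝕜 E]
  {M : Type*} [TopologicalSpace M] [ChartedSpace E M]
  {V : Type*} [NormedAddCommGroup V] [NormedSpace 𝕜 V]
  {V' : Type*} [NormedAddCommGroup V'] [NormedSpace 𝕜 V']

/-- The value of a tensor field as an endomorphism of the model space. -/
def TensorField11.toEnd (G : TensorField11 𝓘(𝕜, E) M) (x : M) : E →L[𝕜] E := G x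

theorem exists_equiv_inCoord {e : OpenPartialHomeomorph M V}
    (he : e.MDifferentiable 𝓘(𝕜, E) 𝓘(𝕜, V)) {v : V} (hv : v ∈ e.target) :
    ∃ D : V ≃L[𝕜] E, (D : V →L[𝕜] E) = mfderiv 𝓘(𝕜, V) 𝓘(𝕜, E) e.symm v ∧
      ∀ G : TensorField11 𝓘(𝕜, E) M,
        G.inCoord e v = D.symm.conjContinuousAlgEquiv (G.toEnd (e.symm v)) := by
  let D : V ≃L[𝕜] E := he.symm.mfderiv hv
  refine ⟨D, rfl, fun G => ?_⟩
  ext w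
  rw [ContinuousLinearEquiv.conjContinuousAlgEquiv_apply_apply, D.eq_symm_apply]
  exact TensorField11.mfderiv_symm_inCoord he hv w

/-- One T serves all tensor fields, so the change of chart also applies to the field of spectral
projections. -/
theorem exists_equiv_inCoord_trans {e : OpenPartialHomeomorph M V}
    {Θ : OpenPartialHomeomorph V V'} (he : e.MDifferentiable 𝓘(𝕜, E) 𝓘(𝕜, V))
    (he' : (e.trans Θ).MDifferentiable 𝓘(𝕜, E) 𝓘(𝕜, V')) {v : V} (hv : v ∈ e.target)
    (hv' : v ∈ Θ.source) (hΘ : DifferentiableAt 𝕜 Θ v) :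
    ∃ T : V ≃L[𝕜] V', (T : V →L[𝕜] V') = fderiv 𝕜 Θ v ∧ ∀ G : TensorField11 𝓘(𝕜, E) M,
      G.inCoord (e.trans Θ) (Θ v) = T.conjContinuousAlgEquiv (G.inCoord e v) := by
  have hinv : (e.trans Θ).symm (Θ v) = e.symm v := by simp [hv']
  have hmem : Θ v ∈ (e.trans Θ).target := by
    simp [Θ.map_source hv', hv', hv]
  obtain ⟨D, hD, hDG⟩ := exists_equiv_inCoord (𝕜 := 𝕜) (E := E) he hv
  obtain ⟨D', hD', hDG'⟩ := exists_equiv_inCoord (𝕜 := 𝕜) (E := E) he' hmem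
  have hcomp : (D' : V' →L[𝕜] E).comp (fderiv 𝕜 Θ v) = D := by
    have h1 : HasMFDerivAt 𝓘(𝕜, V') 𝓘(𝕜, E) (e.trans Θ).symm (Θ v) (D' : V' →L[𝕜] E) := by
      rw [hD']
      exact (he'.mdifferentiableAt_symm hmem).hasMFDerivAt
    have h2 : HasMFDerivAt 𝓘(𝕜, V) 𝓘(𝕜, E) e.symm v (D : V →L[𝕜] E) := by
      rw [hD]
      exact (he.mdifferentiableAt_symm hv).hasMFDerivAt
    have h3 : (e.trans Θ).symm ∘ Θ =ᶠ[𝓝 v] e.symm := by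
      filter_upwards [Θ.open_source.mem_nhds hv'] with y hy
      simp [hy]
    have h4 : HasMFDerivAt 𝓘(𝕜, V) 𝓘(𝕜, E) ((e.trans Θ).symm ∘ Θ) v (D : V →L[𝕜] E) :=
      h2.congr_of_eventuallyEq h3
    exact hasMFDerivAt_unique (HasMFDerivAt.comp v h1 hΘ.hasFDerivAt.hasMFDerivAt) h4
  refine ⟨D.trans D'.symm, ?_, fun G => ?_⟩
  · ext w
    exact D'.symm_apply_eq.2 (DFunLike.congr_fun hcomp w).symm
  · rw [hDG', hDG, hinv]
    ext w
    simp

/-- The field of spectral projections of `G`. -/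
noncomputable def TensorField11.spectral (G : TensorField11 𝓘(𝕜, E) M) (φ₁ φ₂ : M → 𝕜[X]) :
    TensorField11 𝓘(𝕜, E) M :=
  fun x => spectralProj (φ₁ x) (φ₂ x) (G.toEnd x)

theorem TensorField11.charpoly_inCoord [FiniteDimensional 𝕜 E] [FiniteDimensional 𝕜 V]
    {e : OpenPartialHomeomorph M V} (he : e.MDifferentiable 𝓘(𝕜, E) 𝓘(𝕜, V)) {v : V}
    (hv : v ∈ e.target) (G : TensorField11 𝓘(𝕜, E) M) :
    LinearMap.charpoly (G.inCoord e v : V →ₗ[𝕜] V) = G.charpoly (e.symm v) := by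
  obtain ⟨D, -, hD⟩ := exists_equiv_inCoord (𝕜 := 𝕜) (E := E) he hv
  rw [hD, charpoly_conjContinuousAlgEquiv]
  rfl

/-- Spectral projections commute with conjugation, hence transform as a tensor field; knowing them
in one chart determines them in another. -/
theorem TensorField11.spectralProj_inCoord [FiniteDimensional 𝕜 E]
    {e : OpenPartialHomeomorph M V} (he : e.MDifferentiable 𝓘(𝕜, E) 𝓘(𝕜, V)) {v : V}
    (hv : v ∈ e.target) {G : TensorField11 𝓘(𝕜, E) M} {φ₁ φ₂ : M → 𝕜[X]}
    (hfactor : ∀ p, G.charpoly p = φ₁ p * φ₂ p) (hc : ∀ p, IsCoprime (φ₁ p) (φ₂ p)) :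
    spectralProj (φ₁ (e.symm v)) (φ₂ (e.symm v)) (G.inCoord e v) =
      (G.spectral φ₁ φ₂).inCoord e v := by
  obtain ⟨D, -, hD⟩ := exists_equiv_inCoord (𝕜 := 𝕜) (E := E) he hv
  rw [hD, hD, spectralProj_conjContinuousAlgEquiv (g := G.toEnd (e.symm v)) D.symm (hc _)
    (aeval_eq_zero_of_charpoly (hfactor (e.symm v)))]
  rfl

end AdaptedChart

section AdaptedChart

universe u

variable {𝕜 : Type*} [RCLike 𝕜]
  {E : Type*} [NormedAddCommGroup E] [NormedSpace 𝕜 E] [FiniteDimensional 𝕜 E]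
  {M : Type*} [TopologicalSpace M] [ChartedSpace E M] [IsManifold 𝓘(𝕜, E) ∞ M]
  (A B : Type u) [NormedAddCommGroup A] [NormedSpace 𝕜 A] [FiniteDimensional 𝕜 A]
  [NormedAddCommGroup B] [NormedSpace 𝕜 B] [FiniteDimensional 𝕜 B]

/-- Around every point there is a chart in which the spectral projection of a torsion-free tensor
field is a constant coordinate projection. -/
theorem exists_adapted_chart {G : TensorField11 𝓘(𝕜, E) M} (hG : G.Smooth) (hN : G.TorsionFree)
    {φ₁ φ₂ : M → 𝕜[X]}
    (hφ₁ : ∀ k : ℕ, ContMDiff 𝓘(𝕜, E) 𝓘(𝕜, 𝕜) ∞ (fun p => (φ₁ p).coeff k))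
    (hφ₂ : ∀ k : ℕ, ContMDiff 𝓘(𝕜, E) 𝓘(𝕜, 𝕜) ∞ (fun p => (φ₂ p).coeff k))
    (hmonic₁ : ∀ p, (φ₁ p).Monic)
    (hdeg₁ : ∀ p, (φ₁ p).natDegree = Module.finrank 𝕜 A)
    (hdeg₂ : ∀ p, (φ₂ p).natDegree = Module.finrank 𝕜 B)
    (hfactor : ∀ p, G.charpoly p = φ₁ p * φ₂ p)
    (hcoprime : ∀ p, IsCoprime (φ₁ p) (φ₂ p)) (p : M) :
    ∃ e : OpenPartialHomeomorph M (A × B), p ∈ e.source ∧ e p = 0 ∧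
      ContMDiffOn 𝓘(𝕜, E) 𝓘(𝕜, A × B) ∞ e e.source ∧
      ContMDiffOn 𝓘(𝕜, A × B) 𝓘(𝕜, E) ∞ e.symm e.target ∧
      ∀ z ∈ e.target, ∀ v, spectralProj (φ₁ (e.symm z)) (φ₂ (e.symm z)) (G.inCoord e z) v =
        (v.1, 0) := by
  have : CompleteSpace E := FiniteDimensional.complete 𝕜 E
  have : CompleteSpace A := FiniteDimensional.complete 𝕜 A
  have : CompleteSpace B := FiniteDimensional.complete 𝕜 B
  let _ : NormedSpace ℝ A := NormedSpace.restrictScalars ℝ 𝕜 A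
  let _ : NormedSpace ℝ B := NormedSpace.restrictScalars ℝ 𝕜 B
  have : IsScalarTower ℝ 𝕜 A := IsScalarTower.of_algebraMap_smul fun r x => rfl
  have : IsScalarTower ℝ 𝕜 B := IsScalarTower.of_algebraMap_smul fun r x => rfl
  let c := chartAt E p
  have hc : ContMDiffOn 𝓘(𝕜, E) 𝓘(𝕜, E) ∞ c c.source := contMDiffOn_chart
  have hcs : ContMDiffOn 𝓘(𝕜, E) 𝓘(𝕜, E) ∞ c.symm c.target := contMDiffOn_chart_symm
  have hcd : c.MDifferentiable 𝓘(𝕜, E) 𝓘(𝕜, E) :=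
    ⟨hc.mdifferentiableOn (by simp), hcs.mdifferentiableOn (by simp)⟩
  have hp : p ∈ c.source := mem_chart_source E p
  have hcp := c.map_source hp
  -- a chart in which the projection is standard at the point
  obtain ⟨L, hL⟩ := exists_equiv_spectralProj (A := A) (B := B) (hcoprime (c.symm (c p)))
    (hmonic₁ _) ((TensorField11.charpoly_inCoord hcd hcp G).trans (hfactor _)) (hdeg₁ _) (hdeg₂ _)
  let Λ : OpenPartialHomeomorph E (A × B) :=
    ((Homeomorph.addRight (-c p)).trans L.toHomeomorph).toOpenPartialHomeomorph
  have hΛ : ∀ x, Λ x = L (x + -c p) := fun x => rfl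
  have hΛd : HasFDerivAt Λ (L : E →L[𝕜] A × B) (c p) :=
    HasFDerivAt.comp (c p) L.hasFDerivAt ((hasFDerivAt_id _).add_const _)
  have hΛc : ContDiff 𝕜 ∞ Λ := L.contDiff.comp (contDiff_id.add contDiff_const)
  have hΛsc : ContDiff 𝕜 ∞ Λ.symm := L.symm.contDiff.add contDiff_const
  let e₀ := c.trans Λ
  have he₀ : ContMDiffOn 𝓘(𝕜, E) 𝓘(𝕜, A × B) ∞ e₀ e₀.source :=
    hΛc.contMDiff.comp_contMDiffOn (hc.mono fun x hx => hx.1)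
  have he₀s : ContMDiffOn 𝓘(𝕜, A × B) 𝓘(𝕜, E) ∞ e₀.symm e₀.target :=
    hcs.comp hΛsc.contMDiff.contMDiffOn fun z hz => hz.2
  have he₀d : e₀.MDifferentiable 𝓘(𝕜, E) 𝓘(𝕜, A × B) :=
    ⟨he₀.mdifferentiableOn (by simp), he₀s.mdifferentiableOn (by simp)⟩
  have hpe₀ : p ∈ e₀.source := ⟨hp, mem_univ _⟩
  have he₀p : e₀ p = 0 := by
    refine (hΛ (c p)).trans ?_
    rw [add_neg_cancel, map_zero]
  have h0t : (0 : A × B) ∈ e₀.target := he₀p ▸ e₀.map_source hpe₀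
  let g := G.inCoord e₀
  have hg : ContDiffOn 𝕜 ∞ g e₀.target := contDiffOn_inCoord hG he₀ he₀s
  let P : A × B → (A × B) →L[𝕜] (A × B) := fun z =>
    spectralProj (φ₁ (e₀.symm z)) (φ₂ (e₀.symm z)) (g z)
  have h0 : ∀ z ∈ e₀.target,
      Polynomial.aeval (g z) (φ₁ (e₀.symm z) * φ₂ (e₀.symm z)) = 0 := fun z hz =>
    aeval_eq_zero_of_charpoly ((TensorField11.charpoly_inCoord he₀d hz G).trans (hfactor _))
  have hcoeff : ∀ φ : M → 𝕜[X],
      (∀ k : ℕ, ContMDiff 𝓘(𝕜, E) 𝓘(𝕜, 𝕜) ∞ (fun p => (φ p).coeff k)) →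
      ∀ k : ℕ, ContDiffOn 𝕜 ∞ (fun z => (φ (e₀.symm z)).coeff k) e₀.target := fun φ hφ k =>
    ((hφ k).comp_contMDiffOn he₀s).contDiffOn
  have hP : ContDiffOn 𝕜 ∞ P e₀.target :=
    contDiffOn_spectralProj hg (hcoeff φ₁ hφ₁) (hcoeff φ₂ hφ₂) (fun z _ => hdeg₁ _)
      (fun z _ => hdeg₂ _) (fun z _ => hcoprime _) h0
  have hPs : ∀ z ∈ e₀.target,
      spectralProj (φ₂ (e₀.symm z)) (φ₁ (e₀.symm z)) (g z) = 1 - P z := fun z hz =>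
    spectralProj_swap (hcoprime _) (h0 z hz)
  have hnhds : ∀ z ∈ e₀.target, e₀.target ∈ 𝓝 z := fun z hz => e₀.open_target.mem_nhds hz
  have hgd : ∀ z ∈ e₀.target, DifferentiableAt 𝕜 g z := fun z hz =>
    (hg.contDiffAt (hnhds z hz)).differentiableAt (by simp)
  have hPd : ∀ z ∈ e₀.target, DifferentiableAt 𝕜 P z := fun z hz =>
    (hP.contDiffAt (hnhds z hz)).differentiableAt (by simp)
  have htors : ∀ z ∈ e₀.target, ∀ v w, linearTorsion g z v w = 0 := fun z hz =>
    linearTorsion_inCoord hG hN he₀ he₀s hz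
  have hinv : ∀ z ∈ e₀.target, IsInvolutiveAt P z := fun z hz =>
    isInvolutiveAt_spectralProj (hgd z hz) (hPd z hz) (Eventually.of_forall fun y => hcoprime _)
      (by filter_upwards [hnhds z hz] with y hy using h0 y hy) (htors z hz)
  -- The complementary projection is the spectral projection with φ₁ and φ₂ exchanged.
  have hinv' : ∀ z ∈ e₀.target, IsInvolutiveAt (fun y => 1 - P y) z := fun z hz => by
    have hev : (fun y => spectralProj (φ₂ (e₀.symm y)) (φ₁ (e₀.symm y)) (g y)) =ᶠ[𝓝 z]
        fun y => 1 - P y := by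
      filter_upwards [hnhds z hz] with y hy using hPs y hy
    have h := isInvolutiveAt_spectralProj (φ₁ := fun y => φ₂ (e₀.symm y))
      (φ₂ := fun y => φ₁ (e₀.symm y)) (hgd z hz)
      (((differentiableAt_const _).sub (hPd z hz)).congr_of_eventuallyEq hev)
      (Eventually.of_forall fun y => (hcoprime _).symm)
      (by filter_upwards [hnhds z hz] with y hy; rw [mul_comm, h0 y hy]) (htors z hz)
    intro v w
    have h' := h v w
    simp only [hev.fderiv_eq, hPs z hz] at h'
    exact h'
  have hP0 : ∀ v, P 0 v = (v.1, 0) := fun v => by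
    obtain ⟨T, hT, hTG⟩ := exists_equiv_inCoord_trans hcd he₀d hcp (mem_univ _)
      hΛd.differentiableAt
    have hTL : ∀ w, T w = L w := fun w => by
      rw [hΛd.fderiv] at hT
      exact DFunLike.congr_fun hT w
    have hΛ0 : Λ (c p) = 0 := he₀p
    have h1 : P 0 = (G.spectral φ₁ φ₂).inCoord e₀ 0 :=
      TensorField11.spectralProj_inCoord he₀d h0t hfactor hcoprime
    have h2 := hTG (G.spectral φ₁ φ₂)
    rw [hΛ0, ← TensorField11.spectralProj_inCoord hcd hcp hfactor hcoprime] at h2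
    rw [h1, h2, ContinuousLinearEquiv.conjContinuousAlgEquiv_apply_apply, hTL, hL, ← hTL,
      T.apply_symm_apply]
  obtain ⟨Θ, h0Θ, hΘt, hΘ0, hΘ, hΘs, hΘP⟩ := exists_product_coordinates e₀.open_target h0t hP
    (fun z hz => spectralProj_mul_self (hcoprime _) (h0 z hz)) hinv hinv' hP0
  let e := e₀.trans Θ
  have he : ContMDiffOn 𝓘(𝕜, E) 𝓘(𝕜, A × B) ∞ e e.source :=
    hΘ.contMDiffOn.comp (he₀.mono fun x hx => hx.1) fun x hx => hx.2
  have hes : ContMDiffOn 𝓘(𝕜, A × B) 𝓘(𝕜, E) ∞ e.symm e.target :=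
    he₀s.comp (hΘs.contMDiffOn.mono fun z hz => hz.1) fun z hz => hz.2
  have hed : e.MDifferentiable 𝓘(𝕜, E) 𝓘(𝕜, A × B) :=
    ⟨he.mdifferentiableOn (by simp), hes.mdifferentiableOn (by simp)⟩
  refine ⟨e, ⟨hpe₀, ?_⟩, ?_, he, hes, fun z hz v => ?_⟩
  · change e₀ p ∈ Θ.source
    rwa [he₀p]
  · change Θ (e₀ p) = 0
    rw [he₀p, hΘ0]
  -- The new projection is the old one conjugated by T = dΘ, and `hΘP` says that dΘ intertwines it
  -- with the first projection.
  · obtain ⟨y, hy, rfl⟩ : ∃ y ∈ Θ.source, Θ y = z :=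
      ⟨Θ.symm z, Θ.map_target hz.1, Θ.right_inv hz.1⟩
    have hyt := hΘt hy
    obtain ⟨T, hT, hTG⟩ := exists_equiv_inCoord_trans he₀d hed hyt hy
      ((hΘ.contDiffAt (Θ.open_source.mem_nhds hy)).differentiableAt (by simp))
    obtain ⟨w, rfl⟩ := T.surjective v
    have hTw : ∀ w, fderiv 𝕜 Θ y w = T w := fun w => DFunLike.congr_fun hT.symm w
    rw [TensorField11.spectralProj_inCoord hed hz hfactor hcoprime, hTG,
      ← TensorField11.spectralProj_inCoord he₀d hyt hfactor hcoprime,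
      ContinuousLinearEquiv.conjContinuousAlgEquiv_apply_apply, T.symm_apply_apply, ← hTw, ← hTw]
    exact hΘP y hy w

end AdaptedChart

/-! ### Product boxes in a chart as products of manifolds. -/

section ProductBox

open TopologicalSpace

variable {𝕜 : Type*} [RCLike 𝕜]
  {A B : Type*} [NormedAddCommGroup A] [NormedSpace 𝕜 A] [NormedAddCommGroup B] [NormedSpace 𝕜 B]

theorem contMDiff_opens_prod_val (M₁ : Opens A) (M₂ : Opens B) :
    ContMDiff (𝓘(𝕜, A).prod 𝓘(𝕜, B)) 𝓘(𝕜, A × B) ∞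
      (fun z : M₁ × M₂ => ((z.1 : A), (z.2 : B))) :=
  (contMDiff_subtype_val.comp contMDiff_fst).prodMk_space
    (contMDiff_subtype_val.comp contMDiff_snd)

theorem hasMFDerivAt_opens_prod_val {M₁ : Opens A} {M₂ : Opens B} (z : M₁ × M₂) :
    HasMFDerivAt (𝓘(𝕜, A).prod 𝓘(𝕜, B)) 𝓘(𝕜, A × B)
      (fun z : M₁ × M₂ => ((z.1 : A), (z.2 : B))) z (ContinuousLinearMap.id 𝕜 (A × B)) := by
  have h1 : HasMFDerivAt (𝓘(𝕜, A).prod 𝓘(𝕜, B)) 𝓘(𝕜, A) (Subtype.val ∘ Prod.fst) z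
      (ContinuousLinearMap.fst 𝕜 A B) :=
    HasMFDerivAt.comp z (hasMFDerivAt_opens_val z.1) (hasMFDerivAt_fst z)
  have h2 : HasMFDerivAt (𝓘(𝕜, A).prod 𝓘(𝕜, B)) 𝓘(𝕜, B) (Subtype.val ∘ Prod.snd) z
      (ContinuousLinearMap.snd 𝕜 A B) :=
    HasMFDerivAt.comp z (hasMFDerivAt_opens_val z.2) (hasMFDerivAt_snd z)
  exact ⟨h1.1.prodMk h2.1, h1.2.prodMk h2.2⟩

variable {E : Type*} [NormedAddCommGroup E] [NormedSpace 𝕜 E]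
  {M : Type*} [TopologicalSpace M] [ChartedSpace E M]

/-- A product of open sets in the target of a smooth chart parametrizes an open subset. -/
theorem exists_diffeomorph_opens_prod {e : OpenPartialHomeomorph M (A × B)}
    (he : ContMDiffOn 𝓘(𝕜, E) 𝓘(𝕜, A × B) ∞ e e.source)
    (hes : ContMDiffOn 𝓘(𝕜, A × B) 𝓘(𝕜, E) ∞ e.symm e.target) {M₁ : Opens A} {M₂ : Opens B}
    (h : (M₁ : Set A) ×ˢ (M₂ : Set B) ⊆ e.target) :
    ∃ (U : Opens M) (Φ : (M₁ × M₂) ≃ₘ^∞⟮𝓘(𝕜, A).prod 𝓘(𝕜, B), 𝓘(𝕜, E)⟯ U),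
      (∀ p ∈ e.source, (e p).1 ∈ M₁ → (e p).2 ∈ M₂ → p ∈ U) ∧
      ∀ z : M₁ × M₂, (Φ z : M) = e.symm (z.1, z.2) := by
  let U : Opens M := ⟨e.source ∩ e ⁻¹' ((M₁ : Set A) ×ˢ (M₂ : Set B)),
    e.isOpen_inter_preimage (M₁.isOpen.prod M₂.isOpen)⟩
  have hmem : ∀ z : M₁ × M₂, ((z.1 : A), (z.2 : B)) ∈ e.target := fun z => h ⟨z.1.2, z.2.2⟩
  let F : M₁ × M₂ → U := fun z => ⟨e.symm (z.1, z.2), e.map_target (hmem z), by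
    rw [mem_preimage, e.right_inv (hmem z)]; exact ⟨z.1.2, z.2.2⟩⟩
  let F' : U → M₁ × M₂ := fun x => (⟨(e x).1, x.2.2.1⟩, ⟨(e x).2, x.2.2.2⟩)
  have hF : ContMDiff (𝓘(𝕜, A).prod 𝓘(𝕜, B)) 𝓘(𝕜, E) ∞ F := by
    rw [← ContMDiff.subtypeVal_comp_iff]
    exact hes.comp_contMDiff (contMDiff_opens_prod_val M₁ M₂) hmem
  have heU : ContMDiff 𝓘(𝕜, E) 𝓘(𝕜, A × B) ∞ (fun x : U => e x) :=
    he.comp_contMDiff contMDiff_subtype_val fun x => x.2.1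
  have hF' : ContMDiff 𝓘(𝕜, E) (𝓘(𝕜, A).prod 𝓘(𝕜, B)) ∞ F' := by
    refine ContMDiff.prodMk ?_ ?_
    · rw [← ContMDiff.subtypeVal_comp_iff]
      exact contDiff_fst.contMDiff.comp heU
    · rw [← ContMDiff.subtypeVal_comp_iff]
      exact contDiff_snd.contMDiff.comp heU
  let Φ : (M₁ × M₂) ≃ₘ^∞⟮𝓘(𝕜, A).prod 𝓘(𝕜, B), 𝓘(𝕜, E)⟯ U :=
    { toFun := F
      invFun := F'
      left_inv := fun z => by
        have hz := e.right_inv (hmem z)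
        exact Prod.ext (Subtype.ext (congrArg Prod.fst hz)) (Subtype.ext (congrArg Prod.snd hz))
      right_inv := fun x => Subtype.ext (e.left_inv x.2.1)
      contMDiff_toFun := hF
      contMDiff_invFun := hF' }
  exact ⟨U, Φ, fun p hp h1 h2 => ⟨hp, h1, h2⟩, fun z => rfl⟩

theorem related_ofOpens_prod {e : OpenPartialHomeomorph M (A × B)}
    (he : e.MDifferentiable 𝓘(𝕜, E) 𝓘(𝕜, A × B)) {M₁ : Opens A} {M₂ : Opens B}
    (h : (M₁ : Set A) ×ˢ (M₂ : Set B) ⊆ e.target) {G : TensorField11 𝓘(𝕜, E) M}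
    {a : A → A →L[𝕜] A} {b : B → B →L[𝕜] B}
    (hab : ∀ x ∈ M₁, ∀ y ∈ M₂, ∀ v, G.inCoord e (x, y) v = (a x v.1, b y v.2)) :
    TensorField11.Related (fun z : M₁ × M₂ => e.symm (z.1, z.2))
      ((TensorField11.ofOpens 𝕜 M₁ a).prod (TensorField11.ofOpens 𝕜 M₂ b)) G := by
  intro z v
  have hmem : ((z.1 : A), (z.2 : B)) ∈ e.target := h ⟨z.1.2, z.2.2⟩
  have hd : HasMFDerivAt (𝓘(𝕜, A).prod 𝓘(𝕜, B)) 𝓘(𝕜, E)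
      (fun z : M₁ × M₂ => e.symm (z.1, z.2)) z
      (mfderiv 𝓘(𝕜, A × B) 𝓘(𝕜, E) e.symm ((z.1 : A), (z.2 : B))) :=
    HasMFDerivAt.comp z (he.mdifferentiableAt_symm hmem).hasMFDerivAt
      (hasMFDerivAt_opens_prod_val z)
  have hd' := fun u => DFunLike.congr_fun hd.mfderiv u
  refine (hd' _).trans (Eq.trans ?_ (congrArg (G (e.symm (z.1, z.2))) (hd' v)).symm)
  refine Eq.trans ?_ (TensorField11.mfderiv_symm_inCoord he hmem v)
  exact congrArg (mfderiv 𝓘(𝕜, A × B) 𝓘(𝕜, E) e.symm ((z.1 : A), (z.2 : B)))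
    (hab z.1 z.1.2 z.2 z.2.2 v).symm

end ProductBox

end Auxiliary

/-! ### The local product decomposition. -/

theorem propositionA1 {𝕜 : Type*} [RCLike 𝕜]
    {E : Type*} [NormedAddCommGroup E] [NormedSpace 𝕜 E] [FiniteDimensional 𝕜 E]
    {M : Type*} [TopologicalSpace M] [ChartedSpace E M] [IsManifold 𝓘(𝕜, E) ∞ M]
    (G : TensorField11 𝓘(𝕜, E) M) (hG : G.Smooth) (hN : G.TorsionFree)
    (n₁ n₂ : ℕ) (φ₁ φ₂ : M → 𝕜[X])
    (hφ₁ : ∀ k : ℕ, ContMDiff 𝓘(𝕜, E) 𝓘(𝕜, 𝕜) ∞ (fun p => (φ₁ p).coeff k))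
    (hφ₂ : ∀ k : ℕ, ContMDiff 𝓘(𝕜, E) 𝓘(𝕜, 𝕜) ∞ (fun p => (φ₂ p).coeff k))
    (hmonic₁ : ∀ p, (φ₁ p).Monic) (hmonic₂ : ∀ p, (φ₂ p).Monic)
    (hdeg₁ : ∀ p, (φ₁ p).natDegree = n₁) (hdeg₂ : ∀ p, (φ₂ p).natDegree = n₂)
    (hfactor : ∀ p, G.charpoly p = φ₁ p * φ₂ p)
    (hcoprime : ∀ p, IsCoprime (φ₁ p) (φ₂ p)) (p : M) :
    ∃ (U : TopologicalSpace.Opens M)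
      (M₁ : TopologicalSpace.Opens (EuclideanSpace 𝕜 (Fin n₁)))
      (M₂ : TopologicalSpace.Opens (EuclideanSpace 𝕜 (Fin n₂)))
      (Φ : (M₁ × M₂) ≃ₘ^∞⟮𝓘(𝕜, EuclideanSpace 𝕜 (Fin n₁)).prod
        𝓘(𝕜, EuclideanSpace 𝕜 (Fin n₂)), 𝓘(𝕜, E)⟯ U)
      (G₁ : TensorField11 𝓘(𝕜, EuclideanSpace 𝕜 (Fin n₁)) M₁)
      (G₂ : TensorField11 𝓘(𝕜, EuclideanSpace 𝕜 (Fin n₂)) M₂),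
      p ∈ U ∧ G₁.Smooth ∧ G₂.Smooth ∧
      TensorField11.Related (fun z => (Φ z : M)) (G₁.prod G₂) G ∧
      G₁.TorsionFree ∧ G₂.TorsionFree ∧
      (∀ z : M₁ × M₂, G₁.charpoly z.1 = φ₁ (Φ z)) ∧
      (∀ z : M₁ × M₂, G₂.charpoly z.2 = φ₂ (Φ z)) := by
  have : CompleteSpace E := FiniteDimensional.complete 𝕜 E
  obtain ⟨e, hpe, hep, he, hes, hP⟩ := exists_adapted_chart (EuclideanSpace 𝕜 (Fin n₁))
    (EuclideanSpace 𝕜 (Fin n₂)) hG hN hφ₁ hφ₂ hmonic₁ (by simpa using hdeg₁) (by simpa using hdeg₂)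
    hfactor hcoprime p
  have hed : e.MDifferentiable 𝓘(𝕜, E)
      𝓘(𝕜, EuclideanSpace 𝕜 (Fin n₁) × EuclideanSpace 𝕜 (Fin n₂)) :=
    ⟨he.mdifferentiableOn (by simp), hes.mdifferentiableOn (by simp)⟩
  obtain ⟨r, hr, hrt, a, b, ha, hb, hta, htb, hab⟩ := exists_product_form e.open_target
    (hep ▸ e.map_source hpe) (contDiffOn_inCoord hG he hes)
    (fun z hz => linearTorsion_inCoord hG hN he hes hz) (φ₁ := fun z => φ₁ (e.symm z))
    (φ₂ := fun z => φ₂ (e.symm z)) (fun z _ => hcoprime _) (fun z _ => hmonic₁ _)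
    (fun z hz => (TensorField11.charpoly_inCoord hed hz G).trans (hfactor _)) hP
  -- The factors are the balls on which the blocks are defined, centred at the coordinates 0 of p.
  let M₁ : TopologicalSpace.Opens (EuclideanSpace 𝕜 (Fin n₁)) :=
    ⟨Metric.ball 0 r, Metric.isOpen_ball⟩
  let M₂ : TopologicalSpace.Opens (EuclideanSpace 𝕜 (Fin n₂)) :=
    ⟨Metric.ball 0 r, Metric.isOpen_ball⟩
  obtain ⟨U, Φ, hU, hΦ⟩ := exists_diffeomorph_opens_prod he hes (M₁ := M₁) (M₂ := M₂) hrt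
  refine ⟨U, M₁, M₂, Φ, TensorField11.ofOpens 𝕜 M₁ a, TensorField11.ofOpens 𝕜 M₂ b,
    hU p hpe ?_ ?_, TensorField11.smooth_ofOpens ha, TensorField11.smooth_ofOpens hb, ?_,
    TensorField11.torsionFree_ofOpens ha hta, TensorField11.torsionFree_ofOpens hb htb,
    fun z => ?_, fun z => ?_⟩
  · rw [hep]; exact Metric.mem_ball_self hr
  · rw [hep]; exact Metric.mem_ball_self hr
  · have hΦ' : (fun z => (Φ z : M)) = fun z => e.symm (z.1, z.2) := funext hΦ
    rw [hΦ']
    exact related_ofOpens_prod hed hrt fun x hx y hy => (hab x hx y hy).1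
  · rw [hΦ]; exact (hab z.1 z.1.2 z.2 z.2.2).2.1
  · rw [hΦ]; exact (hab z.1 z.1.2 z.2 z.2.2).2.2
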